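/- Let $k, n, j, M, N$ be positive integers with $j \le n$. Let $\mathbb H_n$ be the Siegel upper half space of degree $n$, and let $$\Gamma_0^{(n)}(N)=\Big\{\begin{pmatrix}A&B\\C&D\end{pmatrix}\in \mathrm{Sp}_n(\mathbb Z) : C\equiv 0 \bmod N\Big\},\qquad \Gamma_1^{(n)}(N)=\Big\{\begin{pmatrix}A&B\\C&D\end{pmatrix}\in \Gamma_0^{(n)}(N) : A\equiv D\equiv 1_n \bmod N\Big\}.$$ For such a group $\Gamma$ and a Dirichlet character $\chi$ modulo $N$, let $M_k(\Gamma,\chi)$ be the space of holomorphic functions $F:\mathbb H_n\to\mathbb C$ with $\det(CZ+D)^{-k}F\big((AZ+B)(CZ+D)^{-1}\big)=\chi(\det D)F(Z)$ for all $\begin{pmatrix}A&B\\C&D\end{pmatrix}\in\Gamma$ (and, if $n=1$, bounded at all cusps), and let $M_k(\Gamma)=M_k(\Gamma,1)$. Let $\Lambda_n$ be the lattice of symmetric rational $n\times n$ matrices $T=(t_{ab})$ with $t_{aa},\,2t_{ab}\in\mathbb Z$, and let $F(Z)=\sum_{T\in\Lambda_n}a_F(T)\,e^{2\pi i\,\mathrm{tr}(TZ)}$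 be the Fourier expansion of $F\in M_k(\Gamma_1^{(n)}(N))$ or $F \in M_k(\Gamma_0^{(n)}(N),\chi)$. For $T\in\Lambda_n$ let $T^{[j]}$ be the $\binom nj\times\binom nj$ matrix of all $j\times j$ minors of $T$. As $T$ runs through $\Lambda_n$, the values of a fixed entry of $T^{[j]}$ generate the group $2^{-j}\mathbb Z$, respectively $2^{1-j}\mathbb Z$ for the entries on the diagonal (principal minors) if $j$ is odd. Write $T^{[j]}\equiv 0\bmod M$ if every entry of $T^{[j]}$ is $M$ times an element of the corresponding group. (For odd $M$ this means that $M$ divides the numerators of all entries of $T^{[j]}$; for $j=1$ it means $T\in M\Lambda_n$.) Put $$(F|A^{(j)}(M))(Z):=\sum_{T\in\Lambda_n,\ T^{[j]}\equiv 0\bmod M}a_F(T)\,e^{2\pi i\,\mathrm{tr}(TZ)}.$$ Then this series converges absolutely on $\mathbb H_n$, and: 1. If $F\in M_k(\Gamma_1^{(n)}(N))$, then $F|A^{(j)}(M)\in M_k(\Gamma_1^{(n)}(NM^2))$. 2. If $F\in M_k(\Gamma_0^{(n)}(N),\chi)$ for a Dirichlet character $\chi$ modulo $N$, then $F|A^{(j)}(M)\in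 M_k(\Gamma_0^{(n)}(NM^2),\chi)$, where $\chi$ is also regarded as a character modulo $NM^2$. -/

import Mathlib

open Matrix

noncomputable section

namespace Siegel

/-- The Siegel upper half space of degree `n`, as a set of complex matrices. -/
def upperHalfSpace (n : ℕ) : Set (Matrix (Fin n) (Fin n) ℂ) :=
  {Z | Z.IsSymm ∧ (Z.map Complex.im).PosDef}

/-- The Siegel modular group `Sp_n(ℤ)`, consisting of `2n × 2n` matrices. -/
abbrev ModularGroup (n : ℕ) : Type := symplecticGroup (Fin n) ℤ

variable {n : ℕ}

/-- The block `A` of `g = (A B; C D)`. -/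
def blockA (g : ModularGroup n) : Matrix (Fin n) (Fin n) ℤ := g.1.toBlocks₁₁
/-- The block `B` of `g = (A B; C D)`. -/
def blockB (g : ModularGroup n) : Matrix (Fin n) (Fin n) ℤ := g.1.toBlocks₁₂
/-- The block `C` of `g = (A B; C D)`. -/
def blockC (g : ModularGroup n) : Matrix (Fin n) (Fin n) ℤ := g.1.toBlocks₂₁
/-- The block `D` of `g = (A B; C D)`. -/
def blockD (g : ModularGroup n) : Matrix (Fin n) (Fin n) ℤ := g.1.toBlocks₂₂

/-- Entrywise congruence of integral matrices modulo `N`. -/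
def MatModEq (N : ℕ) (X Y : Matrix (Fin n) (Fin n) ℤ) : Prop :=
  ∀ a b, X a b ≡ Y a b [ZMOD N]

/-- `Γ_0^{(n)}(N)`: the matrices in `Sp_n(ℤ)` with `C ≡ 0 mod N`. -/
def Gamma0 (n N : ℕ) : Set (ModularGroup n) := {g | MatModEq N (blockC g) 0}

/-- `Γ_1^{(n)}(N)`: the matrices in `Sp_n(ℤ)` with `C ≡ 0` and `A ≡ D ≡ 1 mod N`. -/
def Gamma1 (n N : ℕ) : Set (ModularGroup n) :=
  {g | MatModEq N (blockC g) 0 ∧ MatModEq N (blockA g) 1 ∧ MatModEq N (blockD g) 1}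

/-- `CZ + D`. -/
def denom (g : ModularGroup n) (Z : Matrix (Fin n) (Fin n) ℂ) : Matrix (Fin n) (Fin n) ℂ :=
  (blockC g).map (Int.cast : ℤ → ℂ) * Z + (blockD g).map (Int.cast : ℤ → ℂ)

/-- `gZ = (AZ + B)(CZ + D)⁻¹`. -/
def moebius (g : ModularGroup n) (Z : Matrix (Fin n) (Fin n) ℂ) : Matrix (Fin n) (Fin n) ℂ :=
  ((blockA g).map (Int.cast : ℤ → ℂ) * Z + (blockB g).map (Int.cast : ℤ → ℂ)) * (denom g Z)⁻¹

/-- `(F|_k g)(Z) = det(CZ + D)^{-k} F(gZ)`. -/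
def slash (k : ℕ) (F : Matrix (Fin n) (Fin n) ℂ → ℂ) (g : ModularGroup n)
    (Z : Matrix (Fin n) (Fin n) ℂ) : ℂ :=
  ((denom g Z).det ^ k)⁻¹ * F (moebius g Z)

/-- `F ∈ M_k(Γ, χ)` for `Γ` of level `N` and a Dirichlet character `χ` modulo `N`. Functions on
the upper half space are represented by functions on all matrices, of which only the values on
the half space matter. Holomorphy is complex differentiability within the half space, which is
an open subset of the space of symmetric matrices. In degree one, boundedness at
every cusp is required. -/
structure IsModularForm (k N : ℕ) (Γ : Set (ModularGroup n)) (χ : DirichletCharacter ℂ N)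
    (F : Matrix (Fin n) (Fin n) ℂ → ℂ) : Prop where
  holo : DifferentiableOn ℂ F (upperHalfSpace n)
  slash_eq : ∀ g ∈ Γ, ∀ Z ∈ upperHalfSpace n,
    slash k F g Z = χ (((blockD g).det : ℤ) : ZMod N) * F Z
  bdd_at_cusps : n = 1 → ∀ g : ModularGroup n, ∃ c B : ℝ, ∀ Z ∈ upperHalfSpace n,
    (∀ i, c ≤ (Z i i).im) → ‖slash k F g Z‖ ≤ B

/-- The lattice `Λ_n` of half-integral symmetric matrices of size `n`. -/
def halfIntegral (n : ℕ) : Set (Matrix (Fin n) (Fin n) ℚ) :=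
  {T | T.IsSymm ∧ (∀ a, ∃ m : ℤ, T a a = m) ∧ ∀ a b, ∃ m : ℤ, 2 * T a b = m}

/-- `q^T = exp(2πi tr(TZ))`. -/
def qPow (T : Matrix (Fin n) (Fin n) ℚ) (Z : Matrix (Fin n) (Fin n) ℂ) : ℂ :=
  Complex.exp (2 * Real.pi * Complex.I * (T.map (Rat.cast : ℚ → ℂ) * Z).trace)

/-- The point `X + i·1_n` of the upper half space, where `X` is the real symmetric matrix whose
entries on and above the diagonal are given by `x`. -/
def pointAbove (x : Sym2 (Fin n) → ℝ) : Matrix (Fin n) (Fin n) ℂ :=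
  Matrix.of (fun a b => ((x s(a, b) : ℝ) : ℂ)) + Complex.I • (1 : Matrix (Fin n) (Fin n) ℂ)

/-- The Fourier coefficient `a_F(T)`: the integral of `F(Z) exp(-2πi tr(TZ))`, `Z = X + i·1_n`,
over the real symmetric matrices `X` modulo the integral ones. -/
def fourierCoeff (F : Matrix (Fin n) (Fin n) ℂ → ℂ) (T : Matrix (Fin n) (Fin n) ℚ) : ℂ :=
  ∫ x in Set.Icc (0 : Sym2 (Fin n) → ℝ) 1, F (pointAbove x) * (qPow T (pointAbove x))⁻¹

/-- `T^{[j]}`: the matrix of all `j × j` minors of `T`, indexed by pairs of `j`-element subsets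
of the row and column indices (given by their increasing enumerations). -/
def minorMatrix (j : ℕ) (T : Matrix (Fin n) (Fin n) ℚ) :
    Matrix (Fin j ↪o Fin n) (Fin j ↪o Fin n) ℚ :=
  Matrix.of fun I J => (T.submatrix I J).det

/-- The exact denominator of the `(I, J)` entry of `T^{[j]}` for `T ∈ Λ_n`: the values of this
entry on `Λ_n` generate the group `(1 / minorDenom I J) ℤ`. -/
def minorDenom {j : ℕ} (I J : Fin j ↪o Fin n) : ℕ :=
  if I = J ∧ Odd j then 2 ^ (j - 1) else 2 ^ j

/-- `T^{[j]} ≡ 0 mod M`: every entry of `T^{[j]}` is `M` times an element of the group in which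
that entry takes its values. For `j = 1` this says `T ∈ M Λ_n`. For odd `M` it says that `M`
divides the numerators of all entries, as `minorDenom` is a power of two. -/
def MinorsModZero (j M : ℕ) (T : Matrix (Fin n) (Fin n) ℚ) : Prop :=
  ∀ I J : Fin j ↪o Fin n, ∃ m : ℤ, (minorDenom I J : ℚ) * minorMatrix j T I J = M * m

open Classical in
/-- The term of index `T ∈ Λ_n` of the series `F|A^{(j)}(M)`. -/
def termA (j M : ℕ) (F : Matrix (Fin n) (Fin n) ℂ → ℂ) (Z : Matrix (Fin n) (Fin n) ℂ)
    (T : halfIntegral n) : ℂ :=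
  if MinorsModZero j M T.1 then fourierCoeff F T.1 * qPow T.1 Z else 0

/-- `F|A^{(j)}(M)`: the sum of `a_F(T) q^T` over the `T ∈ Λ_n` with `T^{[j]} ≡ 0 mod M`. -/
def opA (j M : ℕ) (F : Matrix (Fin n) (Fin n) ℂ → ℂ) (Z : Matrix (Fin n) (Fin n) ℂ) : ℂ :=
  ∑' T : halfIntegral n, termA j M F Z T

end Siegel

end

/-!
The condition `T^{[j]} ≡ 0 mod M` depends only on `T` modulo `M Λ_n`, so on `Λ_n` its indicator
function is a finite combination of the characters `T ↦ exp(2πi tr(TS)/M)` with integral symmetric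
`S` (`exists_indicator_expansion`). Hence `F|A^{(j)}(M)` is a finite combination of the translates
`Z ↦ F(Z + S/M)`, which gives absolute convergence and holomorphy once the Fourier expansion of `F`
is known to converge absolutely to `F`.

That expansion (`TubeFourier.hasSum_coeff`) holds for every holomorphic function with period lattice
`ℤ^ι` on a tube over an open convex set. The coefficients can be computed on any imaginary part, and
moving the imaginary part against the signs of the frequency gives exponential decay; no growth
condition, and so no Koecher principle, is involved.

For modularity, let `g = (A B; C D)` with `C ≡ 0 mod N M²`. Then `(1 S/M; 0 1) g (1 -S'/M; 0 1)`
with `S' = Dᵀ S D` is integral, has the same `C`, and has `A` and `D` unchanged modulo `N`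
(`exists_conj_Gamma0`). So `g` turns the combination of the translates by `S/M` into the one of the
translates by `Dᵀ S D / M`, and the latter is the same function, since the condition on the minors
is invariant under `T ↦ D T Dᵀ` for `D` invertible modulo `M` (`minorsModZero_conj_iff`, by the
Cauchy–Binet expansion). The factor `2^(j-1)` instead of `2^j` at the principal minors of odd size
needs care: there the relevant integer is half the determinant of an even symmetric matrix of odd
size, which is a polynomial with integral coefficients because alternating matrices of odd size are
singular in characteristic two (`two_mul_dvd_det_sub`).

In degree one, boundedness at the cusps passes to translates by writing `(M S; 0 M) g` as the
product of an element of `SL_2(ℤ)` and a triangular matrix (`bdd_at_cusps_translate`).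
-/

open Matrix

noncomputable section

/-! ### Fourier expansions on tube domains -/

namespace TubeFourier

open MeasureTheory Complex Set Filter Topology

variable {ι : Type*}

/-- The tube `{z ∈ ℂ^ι | Im z ∈ Ω}` over a set `Ω ⊆ ℝ^ι`. -/
def tube (Ω : Set (ι → ℝ)) : Set (ι → ℂ) := {z | (fun i => (z i).im) ∈ Ω}

/-- The point `x + iy` of `ℂ^ι`. -/
def mkPt (x y : ι → ℝ) : ι → ℂ := fun i => x i + I * y i

@[simp]
lemma mkPt_apply (x y : ι → ℝ) (i : ι) : mkPt x y i = x i + I * y i := rfl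

lemma continuous_mkPt : Continuous fun p : (ι → ℝ) × (ι → ℝ) => mkPt p.1 p.2 := by
  refine continuous_pi fun i => ?_
  simp only [mkPt_apply]
  fun_prop

lemma mkPt_mem_tube {Ω : Set (ι → ℝ)} {x y : ι → ℝ} : mkPt x y ∈ tube Ω ↔ y ∈ Ω := by
  simp [tube, mkPt]

lemma isOpen_tube {Ω : Set (ι → ℝ)} (hΩ : IsOpen Ω) : IsOpen (tube Ω) :=
  hΩ.preimage (by fun_prop : Continuous fun z : ι → ℂ => fun i => (z i).im)

/-- A function on `ℝ^ι` with period lattice `ℤ^ι` descends to the torus. -/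
lemma exists_torus_lift (f : (ι → ℝ) → ℂ) (hf : ∀ x (m : ι → ℤ), f (x + fun i => (m i : ℝ)) = f x) :
    ∃ g : UnitAddTorus ι → ℂ, ∀ x : ι → ℝ, g (fun i => (x i : UnitAddCircle)) = f x := by
  have hfac : Function.FactorsThrough f
      (fun (x : ι → ℝ) => ((fun i => (x i : UnitAddCircle)) : UnitAddTorus ι)) := by
    intro x y hxy
    have h1 : ∀ i, ∃ m : ℤ, x i = y i + m := by
      intro i
      have := congrFun hxy i
      simp only at this
      obtain ⟨m, hm⟩ := AddSubgroup.mem_zmultiples_iff.1 (QuotientAddGroup.eq.1 this)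
      refine ⟨-m, ?_⟩
      simp at hm
      push_cast
      linarith
    choose m hm using h1
    rw [← hf y m]
    congr 1
    ext i
    exact hm i
  exact ⟨Function.extend (fun (x : ι → ℝ) => ((fun i => (x i : UnitAddCircle)) : UnitAddTorus ι))
    f 0, fun x => hfac.extend_apply 0 x⟩

lemma continuous_of_comp_mk {g : UnitAddTorus ι → ℂ}
    (hg : Continuous fun x : ι → ℝ => g (fun i => (x i : UnitAddCircle))) : Continuous g := by
  have := IsOpenQuotientMap.piMap (ι := ι) (A := fun _ => ℝ) (B := fun _ => UnitAddCircle)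
    (f := fun _ x => (x : UnitAddCircle)) (fun _ => QuotientAddGroup.isOpenQuotientMap_mk)
  exact this.isQuotientMap.continuous_iff.2 hg

variable [Fintype ι]

/-- The exponential `z ↦ exp(2πi t·z)` with frequency vector `t`. -/
def expo (t : ι → ℤ) (z : ι → ℂ) : ℂ := exp (2 * Real.pi * I * ∑ i, (t i : ℂ) * z i)

lemma expo_ne_zero (t : ι → ℤ) (z : ι → ℂ) : expo t z ≠ 0 := exp_ne_zero _

lemma expo_add_right (t : ι → ℤ) (z w : ι → ℂ) : expo t (z + w) = expo t z * expo t w := by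
  simp only [expo, ← exp_add, Pi.add_apply, mul_add, Finset.sum_add_distrib]

lemma expo_intCast (t m : ι → ℤ) : expo t (fun i => (m i : ℂ)) = 1 := by
  rw [expo, exp_eq_one_iff]
  exact ⟨∑ i, t i * m i, by push_cast; ring⟩

lemma norm_expo (t : ι → ℤ) (z : ι → ℂ) :
    ‖expo t z‖ = Real.exp (-2 * Real.pi * ∑ i, t i * (z i).im) := by
  rw [expo, norm_exp]
  congr 1
  have : (2 * Real.pi * I * ∑ i, (t i : ℂ) * z i) = ((2 * Real.pi : ℝ) : ℂ) *
    (I * ∑ i, (t i : ℂ) * z i) := by push_cast; ring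
  rw [this, re_ofReal_mul, I_mul_re, im_sum]
  simp only [mul_im, intCast_re, intCast_im, zero_mul, add_zero]
  ring

lemma differentiable_expo (t : ι → ℤ) : Differentiable ℂ (expo t) := by
  unfold expo; fun_prop

lemma Icc_ae_eq_box (a : ι → ℝ) :
    ({x : ι → ℝ | ∀ i, x i ∈ Ioc (a i) (a i + 1)} : Set (ι → ℝ)) =ᵐ[volume] Icc a (a + 1) := by
  have := Measure.univ_pi_Ioc_ae_eq_Icc (μ := fun _ : ι => (volume : Measure ℝ)) (f := a)
    (g := a + 1)
  have h : {x : ι → ℝ | ∀ i, x i ∈ Ioc (a i) (a i + 1)}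
      = univ.pi fun i => Ioc (a i) ((a + 1) i) := by ext x; simp
  rwa [h]

/-- The integral of a `ℤ^ι`-periodic function over the unit cube is translation invariant. -/
lemma setIntegral_translate (f : (ι → ℝ) → ℂ)
    (hf : ∀ x (m : ι → ℤ), f (x + fun i => (m i : ℝ)) = f x) (a : ι → ℝ) :
    ∫ x in Icc (0 : ι → ℝ) 1, f (x + a) = ∫ x in Icc (0 : ι → ℝ) 1, f x := by
  obtain ⟨g, hg⟩ := exists_torus_lift f hf
  have key : ∀ a : ι → ℝ, UnitAddTorus.mFourierCoeff g 0 = ∫ x in Icc a (a + 1), f x := by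
    intro a
    rw [UnitAddTorus.mFourierCoeff_eq_integral g 0 a, setIntegral_congr_set (Icc_ae_eq_box a)]
    simp [UnitAddTorus.mFourier_zero, hg]
  have h0 := key 0
  rw [zero_add] at h0
  rw [← h0, key a, ← (measurePreserving_add_right volume a).setIntegral_preimage_emb
    (measurableEmbedding_addRight a) f]
  congr 2
  ext x
  simp [Pi.le_def, add_comm]

variable {Ω : Set (ι → ℝ)} {f : (ι → ℂ) → ℂ}

/-- Differentiation under the integral sign over the unit cube, along a complex line. -/
lemma differentiableAt_integral (hΩ : IsOpen Ω) (hf : DifferentiableOn ℂ f (tube Ω))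
    (y v : ι → ℝ) {w₀ : ℂ} (hw : y + w₀.im • v ∈ Ω) :
    DifferentiableAt ℂ (fun w : ℂ => ∫ x in Icc (0 : ι → ℝ) 1,
      f (mkPt x y + w • fun i => (v i : ℂ))) w₀ := by
  set L : (ι → ℝ) → ℂ → ι → ℂ := fun x w => mkPt x y + w • fun i => (v i : ℂ) with hL
  have hLmem : ∀ x w, L x w ∈ tube Ω ↔ y + w.im • v ∈ Ω := by
    intro x w
    have : (fun i => (L x w i).im) = y + w.im • v := by ext i; simp [hL]
    rw [tube, mem_ofPred_eq, this]
  have hLc : Continuous fun p : (ι → ℝ) × ℂ => L p.1 p.2 := by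
    refine continuous_pi fun i => ?_
    simp only [hL, Pi.add_apply, mkPt_apply, Pi.smul_apply, smul_eq_mul]
    fun_prop
  set U : Set ℂ := {w | y + w.im • v ∈ Ω}
  have hU : IsOpen U := hΩ.preimage (by fun_prop)
  obtain ⟨r, hr, hrU⟩ := Metric.nhds_basis_closedBall.mem_iff.1 (hU.mem_nhds hw)
  have hfc := hf.continuousOn
  obtain ⟨C, hC⟩ := ((isCompact_Icc (a := (0 : ι → ℝ)) (b := 1)).prod
    (isCompact_closedBall w₀ r)).exists_bound_of_continuousOn
    (f := fun p : (ι → ℝ) × ℂ => f (L p.1 p.2))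
    (hfc.comp hLc.continuousOn fun p hp => (hLmem _ _).2 (hrU hp.2))
  have hderiv : ∀ x, ∀ w ∈ U, HasDerivAt (fun w => f (L x w)) (deriv (fun w => f (L x w)) w) w := by
    intro x w hwU
    have h1 : DifferentiableAt ℂ f (L x w) :=
      hf.differentiableAt ((isOpen_tube hΩ).mem_nhds ((hLmem x w).2 hwU))
    have h2 : DifferentiableAt ℂ (L x) w := by simp only [hL]; fun_prop
    exact (h1.comp w h2).hasDerivAt
  have hmeas : ∀ w ∈ U, AEStronglyMeasurable (fun x => f (L x w))
      (volume.restrict (Icc (0 : ι → ℝ) 1)) := by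
    intro w hwU
    refine Continuous.aestronglyMeasurable ?_
    rw [← continuousOn_univ]
    refine hfc.comp (hLc.comp (continuous_id.prodMk continuous_const)).continuousOn ?_
    intro x _
    exact (hLmem x w).2 hwU
  have : IsFiniteMeasure (volume.restrict (Icc (0 : ι → ℝ) 1)) :=
    isFiniteMeasure_restrict.2 isCompact_Icc.measure_lt_top.ne
  refine (hasDerivAt_integral_of_dominated_loc_of_deriv_le (𝕜 := ℂ) (s := Metric.ball w₀ (r / 2))
    (F := fun w x => f (L x w)) (F' := fun w x => deriv (fun w => f (L x w)) w)
    (bound := fun _ => C / (r / 2)) (Metric.ball_mem_nhds _ (half_pos hr))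
    ?_ ?_ ?_ ?_ (integrable_const _) ?_).2.differentiableAt
  · filter_upwards [hU.mem_nhds hw] with w hwU using hmeas w hwU
  · refine Integrable.of_bound (hmeas w₀ hw) C ?_
    refine (ae_restrict_iff' measurableSet_Icc).2 (.of_forall fun x hx => ?_)
    exact hC (x, w₀) ⟨hx, Metric.mem_closedBall_self hr.le⟩
  · -- the derivative is a pointwise limit of difference quotients
    set u : ℕ → ℂ := fun m => w₀ + (r / 2 * (1 / ((m : ℝ) + 1)) : ℝ)
    have hu : Tendsto u atTop (𝓝 w₀) := by
      have := (tendsto_one_div_add_atTop_nhds_zero_nat (𝕜 := ℝ)).const_mul (r / 2)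
      rw [mul_zero] at this
      have h := ((continuous_ofReal.tendsto 0).comp this).const_add w₀
      rw [ofReal_zero, add_zero] at h
      exact h
    have hune : ∀ m, u m ≠ w₀ := by
      intro m h
      have h2 : (r / 2 * (1 / ((m : ℝ) + 1)) : ℝ) = 0 := by
        exact_mod_cast add_eq_left.1 h
      have : 0 < r / 2 * (1 / ((m : ℝ) + 1)) := by positivity
      exact this.ne' h2
    have huU : ∀ m, u m ∈ U := by
      intro m
      apply hrU
      have h1 : 1 / ((m : ℝ) + 1) ≤ 1 := by
        rw [div_le_one (by positivity)]; linarith [(Nat.cast_nonneg m : (0 : ℝ) ≤ m)]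
      have h2 : 0 ≤ 1 / ((m : ℝ) + 1) := by positivity
      simp only [u, Metric.mem_closedBall, dist_eq, add_sub_cancel_left, norm_real]
      rw [Real.norm_of_nonneg (by positivity)]
      nlinarith
    refine aestronglyMeasurable_of_tendsto_ae (ι := ℕ) atTop
      (f := fun m x => slope (fun w => f (L x w)) w₀ (u m)) ?_ (.of_forall fun x => ?_)
    · intro m
      simp only [slope_def_field]
      exact ((hmeas _ (huU m)).sub (hmeas _ hw)).mul_const _ |>.congr
        (.of_forall fun x => (div_eq_mul_inv _ _).symm)
    · refine (hderiv x w₀ hw).tendsto_slope.comp ?_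
      exact tendsto_nhdsWithin_iff.2 ⟨hu, .of_forall hune⟩
  · refine (ae_restrict_iff' measurableSet_Icc).2 (.of_forall fun x hx w hwb => ?_)
    have hsub : Metric.closedBall w (r / 2) ⊆ Metric.closedBall w₀ r := by
      refine Metric.closedBall_subset_closedBall' ?_
      have := Metric.mem_ball.1 hwb
      linarith
    refine norm_deriv_le_of_forall_mem_sphere_norm_le (half_pos hr) ?_ ?_
    · refine DifferentiableOn.diffContOnCl_ball (U := U) ?_ (hsub.trans hrU)
      exact fun w' hw' => (hderiv x w' hw').differentiableAt.differentiableWithinAt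
    · intro z hz
      exact hC (x, z) ⟨hx, hsub (Metric.sphere_subset_closedBall hz)⟩
  · refine (ae_restrict_iff' measurableSet_Icc).2 (.of_forall fun x hx w hwb => ?_)
    refine hderiv x w (hrU (Metric.ball_subset_closedBall ?_))
    exact Metric.ball_subset_ball (by linarith) hwb

/-- Moving the imaginary part: the integral over a period cube of a holomorphic function with
period lattice `ℤ^ι` does not depend on the imaginary part. Along a complex line joining two
imaginary parts the integral is holomorphic, and it is unchanged by real translations; so its
derivative vanishes. -/
lemma integral_indep (hΩ : IsOpen Ω) (hconv : Convex ℝ Ω) (hf : DifferentiableOn ℂ f (tube Ω))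
    (hper : ∀ z ∈ tube Ω, ∀ m : ι → ℤ, f (z + fun i => (m i : ℂ)) = f z)
    {y y' : ι → ℝ} (hy : y ∈ Ω) (hy' : y' ∈ Ω) :
    ∫ x in Icc (0 : ι → ℝ) 1, f (mkPt x y) = ∫ x in Icc (0 : ι → ℝ) 1, f (mkPt x y') := by
  set v : ι → ℝ := y' - y
  set U : Set ℂ := {w | y + w.im • v ∈ Ω}
  have hU : IsOpen U := hΩ.preimage (by fun_prop)
  have hUc : Convex ℝ U := by
    intro a ha b hb s t hs ht hst
    have := hconv ha hb hs ht hst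
    simp only [U, mem_ofPred_eq]
    convert this using 1
    ext i
    simp
    linear_combination -(y i) * hst
  set Φ : ℂ → ℂ := fun w => ∫ x in Icc (0 : ι → ℝ) 1, f (mkPt x y + w • fun i => (v i : ℂ))
  have hdiff : ∀ w ∈ U, DifferentiableAt ℂ Φ w := fun w hw => differentiableAt_integral hΩ hf y v hw
  have htrans : ∀ w ∈ U, ∀ s : ℝ, Φ (w + s) = Φ w := by
    intro w hw s
    have := setIntegral_translate (fun x => f (mkPt x y + w • fun i => (v i : ℂ))) (fun x m => by
      rw [← hper (mkPt x y + w • fun i => (v i : ℂ)) _ m]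
      · congr 1
        ext i
        simp [mkPt]
        ring
      · have : (fun i => ((mkPt x y + w • fun i => (v i : ℂ)) i).im) = y + w.im • v := by
          ext i; simp
        rw [tube, mem_ofPred_eq, this]
        exact hw) (s • v)
    simp only [Φ]
    rw [← this]
    congr 1
    ext x
    congr 1
    ext i
    simp [mkPt]
    ring
  have hzero : EqOn (deriv Φ) 0 U := by
    intro w hw
    have h1 : HasDerivAt (fun s : ℝ => Φ (w + s)) (deriv Φ w) 0 := by
      have h2 : HasDerivAt Φ (deriv Φ w) (w + ((0 : ℝ) : ℂ)) := by
        simpa using (hdiff w hw).hasDerivAt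
      have h3 : HasDerivAt (fun s : ℂ => Φ (w + s)) (deriv Φ w) ((0 : ℝ) : ℂ) :=
        HasDerivAt.comp_const_add w _ h2
      exact h3.comp_ofReal
    have h2 : (fun s : ℝ => Φ (w + s)) = fun _ => Φ w := funext fun s => htrans w hw s
    rw [h2] at h1
    exact h1.unique (hasDerivAt_const _ _)
  have h0 : (0 : ℂ) ∈ U := by simpa [U] using hy
  have h1 : I ∈ U := by simpa [U, v] using hy'
  have := hU.is_const_of_deriv_eq_zero hUc.isPreconnected
    (fun w hw => (hdiff w hw).differentiableWithinAt) hzero h0 h1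
  simp only [Φ] at this
  convert this using 3 with x x
  · simp
  · congr 1
    ext i
    simp [mkPt, v]
    ring

/-- The coefficient of index `t` of the Fourier expansion of `f`, computed on the imaginary
part `y`. -/
def coeff (f : (ι → ℂ) → ℂ) (y : ι → ℝ) (t : ι → ℤ) : ℂ :=
  ∫ x in Icc (0 : ι → ℝ) 1, f (mkPt x y) * (expo t (mkPt x y))⁻¹

lemma coeff_indep (hΩ : IsOpen Ω) (hconv : Convex ℝ Ω) (hf : DifferentiableOn ℂ f (tube Ω))
    (hper : ∀ z ∈ tube Ω, ∀ m : ι → ℤ, f (z + fun i => (m i : ℂ)) = f z)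
    {y y' : ι → ℝ} (hy : y ∈ Ω) (hy' : y' ∈ Ω) (t : ι → ℤ) : coeff f y t = coeff f y' t :=
  integral_indep (f := fun z => f z * (expo t z)⁻¹) hΩ hconv
    (hf.mul ((differentiable_expo t).differentiableOn.inv fun z _ => expo_ne_zero t z))
    (fun z hz m => by simp only [hper z hz m, expo_add_right, expo_intCast, mul_one]) hy hy'

lemma summable_prod_of_summable {g : ℤ → ℝ} (hg : Summable g) (h0 : ∀ u, 0 ≤ g u) :
    Summable fun t : ι → ℤ => ∏ i, g (t i) := by
  classical
  refine summable_of_sum_le (c := ∏ _i : ι, ∑' u, g u)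
    (fun t => Finset.prod_nonneg fun i _ => h0 _) fun s => ?_
  calc ∑ t ∈ s, ∏ i, g (t i)
      ≤ ∑ t ∈ Fintype.piFinset fun i => s.image fun t => t i, ∏ i, g (t i) := by
        refine Finset.sum_le_sum_of_subset_of_nonneg ?_
          fun t _ _ => Finset.prod_nonneg fun i _ => h0 _
        intro t ht
        rw [Fintype.mem_piFinset]
        exact fun i => Finset.mem_image_of_mem _ ht
    _ = ∏ i, ∑ u ∈ s.image fun t => t i, g u := (Finset.prod_univ_sum _ _).symm
    _ ≤ _ := Finset.prod_le_prod (fun i _ => Finset.sum_nonneg fun u _ => h0 u)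
        fun i _ => hg.sum_le_tsum _ fun u _ => h0 u

lemma summable_exp_neg_abs {c : ℝ} (hc : 0 < c) :
    Summable fun u : ℤ => Real.exp (-c * |(u : ℝ)|) := by
  have : Summable fun m : ℕ => Real.exp (-c * m) := by
    have h := Real.summable_exp_nat_mul_iff.2 (neg_lt_zero.2 hc)
    exact h.congr fun m => by rw [mul_comm]
  refine Summable.of_nat_of_neg ?_ ?_ <;> simpa using this

/-- Exponential decay of the terms of the Fourier expansion: to bound the term of index `t`, the
coefficient is computed on an imaginary part moved against the signs of `t`. -/
lemma summable_coeff (hΩ : IsOpen Ω) (hconv : Convex ℝ Ω) (hf : DifferentiableOn ℂ f (tube Ω))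
    (hper : ∀ z ∈ tube Ω, ∀ m : ι → ℤ, f (z + fun i => (m i : ℂ)) = f z)
    {y₀ : ι → ℝ} (hy₀ : y₀ ∈ Ω) {z : ι → ℂ} (hz : z ∈ tube Ω) :
    Summable fun t : ι → ℤ => coeff f y₀ t * expo t z := by
  set y : ι → ℝ := fun i => (z i).im
  have hy : y ∈ Ω := hz
  obtain ⟨r, hr, hrΩ⟩ := Metric.nhds_basis_closedBall.mem_iff.1 (hΩ.mem_nhds hy)
  obtain ⟨C, hC⟩ := ((isCompact_Icc (a := (0 : ι → ℝ)) (b := 1)).prod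
    (isCompact_closedBall y r)).exists_bound_of_continuousOn
    (f := fun p : (ι → ℝ) × (ι → ℝ) => f (mkPt p.1 p.2))
    (hf.continuousOn.comp continuous_mkPt.continuousOn
      fun p hp => mkPt_mem_tube.2 (hrΩ hp.2))
  refine Summable.of_norm_bounded
    ((summable_prod_of_summable (ι := ι)
      (summable_exp_neg_abs (c := 2 * Real.pi * r) (by positivity))
      fun u => (Real.exp_pos _).le).mul_left C) fun t => ?_
  -- then `∑ tᵢ y'ᵢ = ∑ tᵢ yᵢ - r ∑ |tᵢ|`
  set y' : ι → ℝ := fun i => y i - r * SignType.sign (t i : ℝ)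
  have hy'b : y' ∈ Metric.closedBall y r := by
    refine (dist_pi_le_iff hr.le).2 fun i => ?_
    simp only [y', Real.dist_eq, sub_sub_cancel_left, abs_neg, abs_mul, abs_of_pos hr]
    rcases lt_trichotomy (t i : ℝ) 0 with h | h | h
    · simp [sign_neg h]
    · simp [h, hr.le]
    · simp [sign_pos h]
  rw [coeff_indep hΩ hconv hf hper hy₀ (hrΩ hy'b) t, norm_mul]
  have hb : ‖coeff f y' t‖ ≤ C * Real.exp (2 * Real.pi * ∑ i, t i * y' i) := by
    have := norm_setIntegral_le_of_norm_le_const (μ := (volume : Measure (ι → ℝ)))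
      (s := Icc (0 : ι → ℝ) 1) (f := fun x => f (mkPt x y') * (expo t (mkPt x y'))⁻¹)
      (C := C * Real.exp (2 * Real.pi * ∑ i, t i * y' i)) isCompact_Icc.measure_lt_top ?_
    · have hv : (volume : Measure (ι → ℝ)).real (Icc (0 : ι → ℝ) 1) = 1 := by
        rw [Measure.real, Real.volume_Icc_pi_toReal zero_le_one]
        simp
      rwa [hv, mul_one] at this
    · intro x hx
      rw [norm_mul, norm_inv, norm_expo, ← Real.exp_neg]
      have he : -(-2 * Real.pi * ∑ i, t i * (mkPt x y' i).im)
          = 2 * Real.pi * ∑ i, t i * y' i := by simp [mkPt]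
      rw [he]
      exact mul_le_mul_of_nonneg_right (hC (x, y') ⟨hx, hy'b⟩) (Real.exp_pos _).le
  refine (mul_le_mul_of_nonneg_right hb (norm_nonneg _)).trans (le_of_eq ?_)
  rw [norm_expo, mul_assoc, ← Real.exp_add, ← Real.exp_sum]
  congr 2
  rw [Finset.mul_sum, Finset.mul_sum, ← Finset.sum_add_distrib]
  refine Finset.sum_congr rfl fun i _ => ?_
  have hs : (t i : ℝ) * SignType.sign (t i : ℝ) = |(t i : ℝ)| := self_mul_sign _
  simp only [y']
  rw [← hs]
  ring

lemma mFourier_coe (t : ι → ℤ) (x : ι → ℝ) :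
    UnitAddTorus.mFourier t (fun i => (x i : UnitAddCircle)) = expo t (fun i => (x i : ℂ)) := by
  simp only [UnitAddTorus.mFourier, ContinuousMap.coe_mk, fourier_coe_apply, expo, ← exp_sum,
    Finset.mul_sum]
  congr 1
  refine Finset.sum_congr rfl fun i _ => ?_
  simp
  ring

/-- The Fourier expansion of a holomorphic function with period lattice `ℤ^ι` on a tube over an
open convex set: it converges absolutely, with coefficients computed on any fixed imaginary
part. -/
theorem hasSum_coeff (hΩ : IsOpen Ω) (hconv : Convex ℝ Ω) (hf : DifferentiableOn ℂ f (tube Ω))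
    (hper : ∀ z ∈ tube Ω, ∀ m : ι → ℤ, f (z + fun i => (m i : ℂ)) = f z)
    {y₀ : ι → ℝ} (hy₀ : y₀ ∈ Ω) {z : ι → ℂ} (hz : z ∈ tube Ω) :
    HasSum (fun t : ι → ℤ => coeff f y₀ t * expo t z) (f z) := by
  set y : ι → ℝ := fun i => (z i).im
  set x₀ : ι → ℝ := fun i => (z i).re
  have hy : y ∈ Ω := hz
  have hzeq : z = mkPt x₀ y := by
    ext i
    simp only [mkPt, x₀, y]
    rw [mul_comm, re_add_im]
  have hperR : ∀ x (m : ι → ℤ), f (mkPt (x + fun i => (m i : ℝ)) y) = f (mkPt x y) := by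
    intro x m
    rw [← hper (mkPt x y) (mkPt_mem_tube.2 hy) m]
    congr 1
    ext i
    simp [mkPt]
    ring
  obtain ⟨g, hg⟩ := exists_torus_lift (fun x => f (mkPt x y)) hperR
  have hgc : Continuous g := by
    refine continuous_of_comp_mk ?_
    simp only [hg]
    rw [← continuousOn_univ]
    exact hf.continuousOn.comp (continuous_mkPt.comp
      (continuous_id.prodMk continuous_const)).continuousOn fun x _ => mkPt_mem_tube.2 hy
  have hsplit : ∀ t (x : ι → ℝ), expo t (mkPt x y)
      = expo t (fun i => (x i : ℂ)) * expo t (fun i => I * (y i : ℂ)) := by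
    intro t x
    rw [← expo_add_right]
    rfl
  have hcoef : ∀ t, UnitAddTorus.mFourierCoeff g t
      = coeff f y₀ t * expo t (fun i => I * (y i : ℂ)) := by
    intro t
    rw [UnitAddTorus.mFourierCoeff_eq_integral g t 0, setIntegral_congr_set (Icc_ae_eq_box 0),
      zero_add, coeff_indep hΩ hconv hf hper hy₀ hy t, coeff, ← integral_mul_const]
    congr 1
    ext x
    have h1 : expo (-t) (fun i => (x i : ℂ)) = (expo t (fun i => (x i : ℂ)))⁻¹ := by
      rw [expo, expo, ← exp_neg]
      congr 1
      simp
    rw [mFourier_coe, hg, h1, hsplit, smul_eq_mul]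
    have := expo_ne_zero t (fun i => I * (y i : ℂ))
    field_simp
  have hterm : ∀ t, UnitAddTorus.mFourierCoeff g t • UnitAddTorus.mFourier t
      (fun i => (x₀ i : UnitAddCircle)) = coeff f y₀ t * expo t z := by
    intro t
    rw [hcoef, mFourier_coe, hzeq, hsplit, smul_eq_mul]
    ring
  have hsum : Summable (UnitAddTorus.mFourierCoeff g) := by
    have h1 := summable_coeff hΩ hconv hf hper hy₀
      (z := fun i => I * (y i : ℂ)) (by simpa [tube] using hy)
    exact h1.congr fun t => (hcoef t).symm
  have := UnitAddTorus.hasSum_mFourier_series_apply_of_summable (f := ⟨g, hgc⟩) hsum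
    (fun i => (x₀ i : UnitAddCircle))
  simp only [ContinuousMap.coe_mk, hterm, hg] at this
  rwa [← hzeq] at this

end TubeFourier

/-! ### The symplectic action on the upper half space -/

namespace Siegel

variable {n : ℕ}

/-- The entrywise inclusion of integral matrices into complex matrices. -/
abbrev toC (X : Matrix (Fin n) (Fin n) ℤ) : Matrix (Fin n) (Fin n) ℂ :=
  X.map (Int.cast : ℤ → ℂ)

lemma toC_mul (X Y : Matrix (Fin n) (Fin n) ℤ) : toC (X * Y) = toC X * toC Y :=
  Matrix.map_mul (f := Int.castRingHom ℂ)

lemma toC_add (X Y : Matrix (Fin n) (Fin n) ℤ) : toC (X + Y) = toC X + toC Y :=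
  Matrix.map_add _ Int.cast_add X Y

lemma toC_sub (X Y : Matrix (Fin n) (Fin n) ℤ) : toC (X - Y) = toC X - toC Y :=
  Matrix.map_sub _ Int.cast_sub X Y

lemma toC_one : toC (1 : Matrix (Fin n) (Fin n) ℤ) = 1 :=
  Matrix.map_one _ Int.cast_zero Int.cast_one

lemma toC_smul (c : ℤ) (X : Matrix (Fin n) (Fin n) ℤ) : toC (c • X) = (c : ℂ) • toC X := by
  ext
  simp only [map_apply, Matrix.smul_apply, smul_eq_mul, Int.cast_mul]

lemma toC_transpose (X : Matrix (Fin n) (Fin n) ℤ) : toC Xᵀ = (toC X)ᵀ := rfl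

lemma toC_conjTranspose (X : Matrix (Fin n) (Fin n) ℤ) : (toC X)ᴴ = (toC X)ᵀ := by
  ext; simp

lemma fromBlocks_block (g : ModularGroup n) :
    fromBlocks (blockA g) (blockB g) (blockC g) (blockD g) = g.1 :=
  fromBlocks_toBlocks _

/-- The relations between the blocks of a symplectic matrix. -/
lemma block_relations (g : ModularGroup n) :
    (blockA g)ᵀ * blockC g = (blockC g)ᵀ * blockA g ∧
    (blockB g)ᵀ * blockD g = (blockD g)ᵀ * blockB g ∧
    (blockA g)ᵀ * blockD g - (blockC g)ᵀ * blockB g = 1 := by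
  rw [← SymplecticGroup.fromBlocks_mem_iff, fromBlocks_block]
  exact g.2

lemma blockA_mul_transpose_blockD (g : ModularGroup n) :
    blockA g * (blockD g)ᵀ - blockB g * (blockC g)ᵀ = 1 := by
  have h := SymplecticGroup.transpose_mem g.2
  rw [← fromBlocks_block, fromBlocks_transpose, SymplecticGroup.fromBlocks_mem_iff] at h
  simpa using h.2.2

/-- The numerator `AZ + B` of the action of `g` on `Z`. -/
def numer (g : ModularGroup n) (Z : Matrix (Fin n) (Fin n) ℂ) : Matrix (Fin n) (Fin n) ℂ :=
  toC (blockA g) * Z + toC (blockB g)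

lemma moebius_eq (g : ModularGroup n) (Z : Matrix (Fin n) (Fin n) ℂ) :
    moebius g Z = numer g Z * (denom g Z)⁻¹ := rfl

/-- The basic identity for the symplectic action; it is used for `W = Z` and for `W = Zᴴ`. -/
lemma numer_denom_identity (g : ModularGroup n) (Z W : Matrix (Fin n) (Fin n) ℂ) :
    (W * (toC (blockC g))ᵀ + (toC (blockD g))ᵀ) * numer g Z
      - (W * (toC (blockA g))ᵀ + (toC (blockB g))ᵀ) * denom g Z = Z - W := by
  obtain ⟨h1, h2, h3⟩ := block_relations g
  have h4 := congrArg transpose h3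
  rw [transpose_sub, transpose_mul, transpose_mul, transpose_transpose, transpose_transpose,
    transpose_one] at h4
  replace h1 := congrArg toC h1
  replace h2 := congrArg toC h2
  replace h3 := congrArg toC h3
  replace h4 := congrArg toC h4
  simp only [toC_sub, toC_mul, toC_transpose, toC_one] at h1 h2 h3 h4
  unfold numer denom
  change _ - _ * (toC (blockC g) * Z + toC (blockD g)) = _
  generalize toC (blockA g) = A at *
  generalize toC (blockB g) = B at *
  generalize toC (blockC g) = C at *
  generalize toC (blockD g) = D at *
  calc _ = W * (Cᵀ * A - Aᵀ * C) * Z - W * (Aᵀ * D - Cᵀ * B) + (Dᵀ * A - Bᵀ * C) * Z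
        + (Dᵀ * B - Bᵀ * D) := by noncomm_ring
    _ = _ := by rw [h1, h2, h3, h4]; simp; abel

lemma symm_identity (g : ModularGroup n) {Z : Matrix (Fin n) (Fin n) ℂ} (hZ : Zᵀ = Z) :
    (denom g Z)ᵀ * numer g Z = (numer g Z)ᵀ * denom g Z := by
  have h := numer_denom_identity g Z Z
  rw [sub_self, sub_eq_zero] at h
  simpa [denom, numer, transpose_add, transpose_mul, hZ] using h

lemma hermitian_identity (g : ModularGroup n) (Z : Matrix (Fin n) (Fin n) ℂ) :
    (denom g Z)ᴴ * numer g Z - (numer g Z)ᴴ * denom g Z = Z - Zᴴ := by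
  have h := numer_denom_identity g Z Zᴴ
  simpa only [denom, numer, conjTranspose_add, conjTranspose_mul, toC_conjTranspose] using h

/-- For symmetric `W`, the skew-hermitian form of `W - Wᴴ` is `2i` times the form of `Im W`; its
imaginary part splits into the real and the imaginary part of the vector. -/
lemma im_form_sub_conjTranspose {W : Matrix (Fin n) (Fin n) ℂ} (hW : Wᵀ = W) (v : Fin n → ℂ) :
    (star v ⬝ᵥ ((W - Wᴴ) *ᵥ v)).im
      = 2 * ((fun i => (v i).re) ⬝ᵥ (W.map Complex.im *ᵥ fun i => (v i).re)
        + (fun i => (v i).im) ⬝ᵥ (W.map Complex.im *ᵥ fun i => (v i).im)) := by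
  have hent : ∀ a b, (W - Wᴴ) a b = 2 * Complex.I * ((W a b).im : ℂ) := by
    intro a b
    have hba : W b a = W a b := congrFun (congrFun hW a) b
    rw [Matrix.sub_apply, conjTranspose_apply, hba, RCLike.star_def, Complex.sub_conj]
    push_cast; ring
  simp only [dotProduct, mulVec, hent, Finset.mul_sum, Complex.im_sum, ← Finset.sum_add_distrib,
    map_apply]
  refine Finset.sum_congr rfl fun a _ => Finset.sum_congr rfl fun b _ => ?_
  simp
  ring

lemma posDef_form_pos {Y : Matrix (Fin n) (Fin n) ℝ} (hY : Y.PosDef) {v : Fin n → ℂ}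
    (hv : v ≠ 0) :
    0 < (fun i => (v i).re) ⬝ᵥ (Y *ᵥ fun i => (v i).re)
        + (fun i => (v i).im) ⬝ᵥ (Y *ᵥ fun i => (v i).im) := by
  have hpos : ∀ x : Fin n → ℝ, x ≠ 0 → 0 < x ⬝ᵥ (Y *ᵥ x) := fun x hx => by
    simpa using hY.dotProduct_mulVec_pos hx
  have hnn : ∀ x : Fin n → ℝ, 0 ≤ x ⬝ᵥ (Y *ᵥ x) := fun x => by
    by_cases hx : x = 0
    · simp [hx]
    · exact (hpos x hx).le
  by_cases h : (fun i => (v i).re) = 0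
  · refine add_pos_of_nonneg_of_pos (hnn _) (hpos _ fun h' => hv ?_)
    ext i
    exact Complex.ext (congrFun h i) (congrFun h' i)
  · exact add_pos_of_pos_of_nonneg (hpos _ h) (hnn _)

/-- `CZ + D` is invertible for `Z` in the upper half space. -/
lemma det_denom_ne_zero (g : ModularGroup n) {Z : Matrix (Fin n) (Fin n) ℂ}
    (hZ : Z ∈ upperHalfSpace n) : (denom g Z).det ≠ 0 := by
  intro h
  obtain ⟨v, hv, hQv⟩ := exists_mulVec_eq_zero_iff.2 h
  have h1 : star v ⬝ᵥ ((Z - Zᴴ) *ᵥ v) = 0 := by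
    rw [← hermitian_identity g Z, sub_mulVec, ← mulVec_mulVec, ← mulVec_mulVec, hQv,
      mulVec_zero, sub_zero, dotProduct_mulVec, ← star_mulVec, hQv, star_zero, zero_dotProduct]
  have h2 := im_form_sub_conjTranspose hZ.1 v
  rw [h1, Complex.zero_im] at h2
  have := posDef_form_pos hZ.2 hv
  linarith

lemma isUnit_det_denom (g : ModularGroup n) {Z : Matrix (Fin n) (Fin n) ℂ}
    (hZ : Z ∈ upperHalfSpace n) : IsUnit (denom g Z).det :=
  isUnit_iff_ne_zero.2 (det_denom_ne_zero g hZ)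

lemma mem_upperHalfSpace_of_form {W : Matrix (Fin n) (Fin n) ℂ} (hW : Wᵀ = W)
    (h : ∀ v : Fin n → ℂ, v ≠ 0 → 0 < (star v ⬝ᵥ ((W - Wᴴ) *ᵥ v)).im) :
    W ∈ upperHalfSpace n := by
  refine ⟨hW, PosDef.of_dotProduct_mulVec_pos ?_ fun x hx => ?_⟩
  · ext a b
    have hba : W b a = W a b := congrFun (congrFun hW a) b
    simp [hba]
  · have h1 := h (fun i => (x i : ℂ)) fun h0 => hx <| by
      ext i
      exact Complex.ofReal_eq_zero.1 (congrFun h0 i)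
    rw [im_form_sub_conjTranspose hW] at h1
    simpa using h1

/-- The action of the Siegel modular group preserves the upper half space. -/
lemma moebius_mem (g : ModularGroup n) {Z : Matrix (Fin n) (Fin n) ℂ}
    (hZ : Z ∈ upperHalfSpace n) : moebius g Z ∈ upperHalfSpace n := by
  have hu := isUnit_det_denom g hZ
  have hWQ : moebius g Z * denom g Z = numer g Z := by
    rw [moebius_eq, Matrix.mul_assoc, nonsing_inv_mul _ hu, Matrix.mul_one]
  have hQ : ∀ v : Fin n → ℂ, denom g Z *ᵥ ((denom g Z)⁻¹ *ᵥ v) = v := fun v => by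
    rw [mulVec_mulVec, mul_nonsing_inv _ hu, one_mulVec]
  refine mem_upperHalfSpace_of_form ?_ fun v hv => ?_
  · have h := symm_identity g hZ.1
    rw [← hWQ, transpose_mul, ← Matrix.mul_assoc] at h
    have h2 := congrArg (fun X => X * (denom g Z)⁻¹) h
    simp only [Matrix.mul_assoc, mul_nonsing_inv _ hu, Matrix.mul_one] at h2
    have hut : IsUnit (denom g Z)ᵀ.det := by rwa [det_transpose]
    have h3 := congrArg (fun X => (denom g Z)ᵀ⁻¹ * X) h2
    simp only [← Matrix.mul_assoc, nonsing_inv_mul _ hut, Matrix.one_mul] at h3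
    exact h3.symm
  · set u := (denom g Z)⁻¹ *ᵥ v
    have huv : denom g Z *ᵥ u = v := hQ v
    have hu0 : u ≠ 0 := by
      rintro h
      rw [h, mulVec_zero] at huv
      exact hv huv.symm
    have h1 : star v ⬝ᵥ ((moebius g Z - (moebius g Z)ᴴ) *ᵥ v)
        = star u ⬝ᵥ ((Z - Zᴴ) *ᵥ u) := by
      rw [← hermitian_identity g Z, ← hWQ, ← huv, star_mulVec, ← dotProduct_mulVec,
        mulVec_mulVec, mulVec_mulVec, conjTranspose_mul]
      congr 2
      noncomm_ring
    rw [h1, im_form_sub_conjTranspose hZ.1]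
    have := posDef_form_pos hZ.2 hu0
    linarith

/-- The upper half space is stable under translation by real symmetric matrices. -/
lemma add_mem_upperHalfSpace {Z s : Matrix (Fin n) (Fin n) ℂ} (hZ : Z ∈ upperHalfSpace n)
    (hs : sᵀ = s) (hr : ∀ a b, (s a b).im = 0) : Z + s ∈ upperHalfSpace n := by
  refine ⟨?_, ?_⟩
  · rw [IsSymm, transpose_add, hs, hZ.1]
  · convert hZ.2 using 1
    ext a b
    simp [hr]

lemma unipotent_mem {s : Matrix (Fin n) (Fin n) ℂ} (hs : sᵀ = s) :
    fromBlocks 1 s 0 1 ∈ symplecticGroup (Fin n) ℂ := by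
  rw [SymplecticGroup.fromBlocks_mem_iff]
  simp [hs]

lemma mem_symplecticGroup_of_map {G : Matrix (Fin n ⊕ Fin n) (Fin n ⊕ Fin n) ℤ}
    (hG : G.map (Int.castRingHom ℂ) ∈ symplecticGroup (Fin n) ℂ) :
    G ∈ symplecticGroup (Fin n) ℤ := by
  have h := SymplecticGroup.mem_iff.1 hG
  refine SymplecticGroup.mem_iff.2 (Matrix.map_injective
    (RingHom.injective_int (Int.castRingHom ℂ)) ?_)
  beta_reduce
  rw [Matrix.map_mul, Matrix.map_mul, map_J, transpose_map]
  exact h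

/-- If the matrix `(1 s; 0 1) g (1 -s'; 0 1)` has integral entries, it is an element of the
modular group. -/
lemma exists_conj_translation (g : ModularGroup n) {s s' : Matrix (Fin n) (Fin n) ℂ}
    (hs : sᵀ = s) (hs' : s'ᵀ = s') {A' B' D' : Matrix (Fin n) (Fin n) ℤ}
    (hA : toC A' = toC (blockA g) + s * toC (blockC g))
    (hB : toC B' = toC (blockB g) + s * toC (blockD g) - toC A' * s')
    (hD : toC D' = toC (blockD g) - toC (blockC g) * s') :
    ∃ g' : ModularGroup n, blockA g' = A' ∧ blockB g' = B' ∧ blockC g' = blockC g ∧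
      blockD g' = D' := by
  set G := fromBlocks A' B' (blockC g) D'
  have hG : G.map (Int.castRingHom ℂ) ∈ symplecticGroup (Fin n) ℂ := by
    have h1 : G.map (Int.castRingHom ℂ)
        = fromBlocks 1 s 0 1 * g.1.map (Int.castRingHom ℂ) * fromBlocks 1 (-s') 0 1 := by
      rw [← fromBlocks_block g, fromBlocks_map, fromBlocks_map, fromBlocks_multiply,
        fromBlocks_multiply]
      simp only [Matrix.one_mul, Matrix.zero_mul, Matrix.mul_one, Matrix.mul_zero, add_zero,
        zero_add, Matrix.mul_neg]
      change fromBlocks (toC A') (toC B') (toC (blockC g)) (toC D') = fromBlocks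
        (toC (blockA g) + s * toC (blockC g)) (-((toC (blockA g) + s * toC (blockC g)) * s')
          + (toC (blockB g) + s * toC (blockD g)))
        (toC (blockC g)) (-(toC (blockC g) * s') + toC (blockD g))
      rw [← hA, hB, hD]
      congr 1 <;> abel
    have hs'' : (-s')ᵀ = -s' := by rw [transpose_neg, hs']
    have hg := SymplecticGroup.map_mem g.2 (Int.castRingHom ℂ)
    rw [h1]
    exact Submonoid.mul_mem _ (Submonoid.mul_mem _ (unipotent_mem hs) hg) (unipotent_mem hs'')
  have hGZ : G ∈ symplecticGroup (Fin n) ℤ := mem_symplecticGroup_of_map hG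
  exact ⟨⟨G, hGZ⟩, toBlocks_fromBlocks₁₁ _ _ _ _, toBlocks_fromBlocks₁₂ _ _ _ _,
    toBlocks_fromBlocks₂₁ _ _ _ _, toBlocks_fromBlocks₂₂ _ _ _ _⟩

section conj

variable {g g' : ModularGroup n} {s s' : Matrix (Fin n) (Fin n) ℂ}

lemma denom_add_of_conj (hC : blockC g' = blockC g)
    (hD : toC (blockD g') = toC (blockD g) - toC (blockC g) * s')
    (Z : Matrix (Fin n) (Fin n) ℂ) : denom g' (Z + s') = denom g Z := by
  change toC (blockC g') * (Z + s') + toC (blockD g') = toC (blockC g) * Z + toC (blockD g)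
  rw [hC, hD]
  noncomm_ring

lemma moebius_add_of_conj (hA : toC (blockA g') = toC (blockA g) + s * toC (blockC g))
    (hB : toC (blockB g') = toC (blockB g) + s * toC (blockD g) - toC (blockA g') * s')
    (hC : blockC g' = blockC g)
    (hD : toC (blockD g') = toC (blockD g) - toC (blockC g) * s')
    {Z : Matrix (Fin n) (Fin n) ℂ} (hZ : Z ∈ upperHalfSpace n) :
    moebius g' (Z + s') = moebius g Z + s := by
  have hnum : numer g' (Z + s') = numer g Z + s * denom g Z := by
    change toC (blockA g') * (Z + s') + toC (blockB g') = toC (blockA g) * Z + toC (blockB g)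
      + s * (toC (blockC g) * Z + toC (blockD g))
    rw [hB, hA]
    noncomm_ring
  rw [moebius_eq, moebius_eq, denom_add_of_conj hC hD, hnum, Matrix.add_mul, Matrix.mul_assoc,
    mul_nonsing_inv _ (isUnit_det_denom g hZ), Matrix.mul_one]

end conj

end Siegel

/-! ### The Fourier expansion on the upper half space -/

namespace Siegel

variable {n : ℕ}

/-- The symmetric matrix with given entries on and above the diagonal. -/
def symMat {R : Type*} (z : Sym2 (Fin n) → R) : Matrix (Fin n) (Fin n) R :=
  Matrix.of fun a b => z s(a, b)

@[simp]
lemma symMat_apply {R : Type*} (z : Sym2 (Fin n) → R) (a b : Fin n) :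
    symMat z a b = z s(a, b) := rfl

lemma symMat_transpose {R : Type*} (z : Sym2 (Fin n) → R) : (symMat z)ᵀ = symMat z := by
  ext a b
  simp [Sym2.eq_swap]

lemma exists_symMat {R : Type*} {Z : Matrix (Fin n) (Fin n) R} (hZ : Zᵀ = Z) :
    ∃ z : Sym2 (Fin n) → R, symMat z = Z := by
  refine ⟨fun s => Z s.inf s.sup, ?_⟩
  ext a b
  simp only [symMat_apply, Sym2.inf_mk, Sym2.sup_mk]
  rcases le_total a b with h | h
  · rw [inf_eq_left.2 h, sup_eq_right.2 h]
  · rw [inf_eq_right.2 h, sup_eq_left.2 h]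
    exact congrFun (congrFun hZ a) b

/-- The cone of positive definite matrices, in coordinates. -/
def posCone (n : ℕ) : Set (Sym2 (Fin n) → ℝ) := {y | (symMat y).PosDef}

lemma mem_posCone {y : Sym2 (Fin n) → ℝ} :
    y ∈ posCone n ↔ ∀ x : Fin n → ℝ, x ≠ 0 → 0 < x ⬝ᵥ (symMat y *ᵥ x) := by
  rw [posCone, Set.mem_ofPred_eq, posDef_iff_dotProduct_mulVec]
  simp only [star_trivial]
  refine ⟨fun h x hx => h.2 hx, fun h => ⟨?_, fun {x} hx => h x hx⟩⟩
  rw [IsHermitian, conjTranspose_eq_transpose_of_trivial, symMat_transpose]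

lemma convex_posCone : Convex ℝ (posCone n) := by
  intro y hy y' hy' s t hs ht hst
  rw [mem_posCone] at *
  intro x hx
  have h1 : symMat (s • y + t • y') = s • symMat y + t • symMat y' := by ext; simp
  rw [h1, add_mulVec, smul_mulVec, smul_mulVec, dotProduct_add, dotProduct_smul, dotProduct_smul,
    smul_eq_mul, smul_eq_mul]
  have h2 := hy x hx
  have h3 := hy' x hx
  rcases hs.eq_or_lt with h | h
  · have : t = 1 := by linarith
    rw [← h, this]; linarith
  · have := mul_pos h h2
    have := mul_nonneg ht h3.le
    linarith

/-- Positivity of the form on the (compact) unit sphere is an open condition. -/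
lemma isOpen_posCone : IsOpen (posCone n) := by
  have hiff : posCone n = {y | ∀ x ∈ Metric.sphere (0 : Fin n → ℝ) 1,
      0 < x ⬝ᵥ (symMat y *ᵥ x)} := by
    ext y
    rw [mem_posCone]
    refine ⟨fun h x hx => h x fun h0 => ?_, fun h x hx => ?_⟩
    · simp [h0] at hx
    · have hn : 0 < ‖x‖ := norm_pos_iff.2 hx
      have h1 := h (‖x‖⁻¹ • x) (by simp [norm_smul, hn.ne'])
      rw [mulVec_smul, dotProduct_smul, smul_dotProduct, smul_eq_mul, smul_eq_mul] at h1
      exact pos_of_mul_pos_right (pos_of_mul_pos_right h1 (by positivity)) (by positivity)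
  rw [hiff, isOpen_iff_eventually]
  intro y hy
  refine (isCompact_sphere _ _).eventually_forall_of_forall_eventually fun x hx => ?_
  have hc : Continuous fun p : (Sym2 (Fin n) → ℝ) × (Fin n → ℝ) =>
      p.2 ⬝ᵥ (symMat p.1 *ᵥ p.2) := by
    simp only [dotProduct, mulVec, symMat_apply]
    fun_prop
  exact hc.continuousAt.eventually (lt_mem_nhds (hy x hx))

lemma mem_tube_iff {z : Sym2 (Fin n) → ℂ} :
    z ∈ TubeFourier.tube (posCone n) ↔ symMat z ∈ upperHalfSpace n := by
  have h : symMat (fun i => (z i).im) = (symMat z).map Complex.im := rfl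
  rw [TubeFourier.tube, Set.mem_ofPred_eq, posCone, Set.mem_ofPred_eq, h]
  exact ⟨fun h => ⟨symMat_transpose z, h⟩, fun h => h.2⟩

/-- The coordinates of the identity matrix. -/
def oneCoord (n : ℕ) : Sym2 (Fin n) → ℝ := fun s => (1 : Matrix (Fin n) (Fin n) ℝ) s.inf s.sup

lemma symMat_oneCoord : symMat (oneCoord n) = 1 := by
  ext a b
  simp only [symMat_apply, oneCoord, Sym2.inf_mk, Sym2.sup_mk, one_apply]
  congr 1
  rw [eq_iff_iff]
  exact inf_eq_sup

lemma oneCoord_mem : oneCoord n ∈ posCone n := by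
  rw [posCone, Set.mem_ofPred_eq, symMat_oneCoord]
  exact PosDef.one

lemma pointAbove_eq (x : Sym2 (Fin n) → ℝ) :
    pointAbove x = symMat (TubeFourier.mkPt x (oneCoord n)) := by
  ext a b
  have h : oneCoord n s(a, b) = (1 : Matrix (Fin n) (Fin n) ℝ) a b := by
    rw [← symMat_oneCoord, symMat_apply]
  simp only [pointAbove, Matrix.add_apply, of_apply, Matrix.smul_apply, smul_eq_mul, symMat_apply,
    TubeFourier.mkPt_apply, h, one_apply]
  split_ifs <;> simp

/-- The half-integral matrix whose pairing with symmetric matrices has the given integral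
coordinates. -/
def halfMat (t : Sym2 (Fin n) → ℤ) : Matrix (Fin n) (Fin n) ℚ :=
  Matrix.of fun a b => if a = b then (t s(a, b) : ℚ) else t s(a, b) / 2

lemma halfMat_mem (t : Sym2 (Fin n) → ℤ) : halfMat t ∈ halfIntegral n := by
  refine ⟨?_, fun a => ⟨t s(a, a), by simp [halfMat]⟩, fun a b => ?_⟩
  · ext a b
    simp [halfMat, Sym2.eq_swap, eq_comm]
  · by_cases h : a = b
    · exact ⟨2 * t s(a, b), by simp [halfMat, h]⟩
    · exact ⟨t s(a, b), by simp [halfMat, h]; ring⟩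

lemma halfMat_bijective :
    Function.Bijective fun t : Sym2 (Fin n) → ℤ => (⟨halfMat t, halfMat_mem t⟩ : halfIntegral n) := by
  constructor
  · intro t t' h
    ext s
    induction s with | _ a b =>
    have := congrFun (congrFun (congrArg Subtype.val h) a) b
    simp only [halfMat, of_apply] at this
    split_ifs at this
    · exact_mod_cast this
    · field_simp at this
      exact_mod_cast this
  · rintro ⟨T, hT, hd, ho⟩
    obtain ⟨d, hd'⟩ := Classical.skolem.1 hd
    obtain ⟨o, ho'⟩ := Classical.skolem.1 fun a => Classical.skolem.1 (ho a)
    refine ⟨fun s => if s.inf = s.sup then d s.inf else o s.inf s.sup, Subtype.ext ?_⟩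
    ext a b
    simp only [halfMat, of_apply, Sym2.inf_mk, Sym2.sup_mk, inf_eq_sup]
    split_ifs with h
    · subst h
      simp [hd']
    · have : T (a ⊓ b) (a ⊔ b) = T a b := by
        rcases le_total a b with h | h
        · rw [inf_eq_left.2 h, sup_eq_right.2 h]
        · rw [inf_eq_right.2 h, sup_eq_left.2 h]
          exact congrFun (congrFun hT a) b
      rw [← ho', this]
      ring

/-- The trace pairing in coordinates: an off-diagonal coordinate occurs twice, with half the
weight. -/
lemma trace_halfMat_mul (t : Sym2 (Fin n) → ℤ) (z : Sym2 (Fin n) → ℂ) :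
    ((halfMat t).map (Rat.cast : ℚ → ℂ) * symMat z).trace = ∑ s, (t s : ℂ) * z s := by
  simp only [trace, diag_apply, mul_apply, map_apply, symMat_apply]
  rw [← Finset.sum_product', Finset.univ_product_univ,
    ← Finset.sum_fiberwise (s := Finset.univ) (g := fun p : Fin n × Fin n => s(p.1, p.2))]
  refine Finset.sum_congr rfl fun s _ => ?_
  induction s with | _ a b =>
  have hfib : (Finset.univ.filter fun p : Fin n × Fin n => s(p.1, p.2) = s(a, b))
      = {(a, b), (b, a)} := by
    ext ⟨c, d⟩
    simp
  rw [hfib]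
  by_cases h : a = b
  · subst h
    simp [halfMat]
  · rw [Finset.sum_pair (by simp [h])]
    simp only [halfMat, of_apply, h, Ne.symm h, if_false, Sym2.eq_swap (a := b) (b := a)]
    push_cast
    ring

lemma expo_eq_qPow (t : Sym2 (Fin n) → ℤ) (z : Sym2 (Fin n) → ℂ) :
    TubeFourier.expo t z = qPow (halfMat t) (symMat z) := by
  rw [TubeFourier.expo, qPow, trace_halfMat_mul]

lemma coeff_eq_fourierCoeff (F : Matrix (Fin n) (Fin n) ℂ → ℂ) (t : Sym2 (Fin n) → ℤ) :
    TubeFourier.coeff (fun z => F (symMat z)) (oneCoord n) t = fourierCoeff F (halfMat t) := by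
  simp only [TubeFourier.coeff, fourierCoeff, expo_eq_qPow, pointAbove_eq]

section differentiability

-- The entrywise sup norm induces the topology with respect to which differentiability is defined,
-- and gives access to the chain rule for normed spaces.
attribute [local instance] Matrix.normedAddCommGroup Matrix.normedSpace

lemma differentiableOn_comp_clm {F : Matrix (Fin n) (Fin n) ℂ → ℂ}
    {H : Set (Matrix (Fin n) (Fin n) ℂ)} (hF : DifferentiableOn ℂ F H)
    {E : Type*} [NormedAddCommGroup E] [NormedSpace ℂ E] (L : E →L[ℂ] Matrix (Fin n) (Fin n) ℂ)
    {U : Set E} (hU : ∀ z ∈ U, L z ∈ H) : DifferentiableOn ℂ (fun z => F (L z)) U :=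
  DifferentiableOn.comp (E := E) (F := Matrix (Fin n) (Fin n) ℂ) hF
    L.differentiable.differentiableOn hU

/-- A finite linear combination of translates of a holomorphic function is holomorphic. -/
lemma differentiableOn_sum_translate {F : Matrix (Fin n) (Fin n) ℂ → ℂ}
    {H : Set (Matrix (Fin n) (Fin n) ℂ)} (hF : DifferentiableOn ℂ F H) {κ : Type*} (I : Finset κ)
    (c : κ → ℂ) (s : κ → Matrix (Fin n) (Fin n) ℂ) (hs : ∀ i ∈ I, ∀ Z ∈ H, Z + s i ∈ H) :
    DifferentiableOn ℂ (fun Z => ∑ i ∈ I, c i * F (Z + s i)) H := by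
  refine DifferentiableOn.fun_sum (E := Matrix (Fin n) (Fin n) ℂ) fun i hi => ?_
  refine DifferentiableOn.const_mul (E := Matrix (Fin n) (Fin n) ℂ) ?_ _
  exact DifferentiableOn.comp (E := Matrix (Fin n) (Fin n) ℂ) (F := Matrix (Fin n) (Fin n) ℂ)
    (g := F) (f := fun Z => Z + s i) hF
    ((differentiable_id (𝕜 := ℂ) (E := Matrix (Fin n) (Fin n) ℂ)).add_const
      (s i)).differentiableOn (hs i hi)

end differentiability

/-- The Fourier expansion of a holomorphic function on the upper half space that is invariant
under integral translations. No growth condition is needed for it. -/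
theorem hasSum_fourierCoeff {F : Matrix (Fin n) (Fin n) ℂ → ℂ}
    (hF : DifferentiableOn ℂ F (upperHalfSpace n))
    (hper : ∀ Z ∈ upperHalfSpace n, ∀ S : Matrix (Fin n) (Fin n) ℤ, Sᵀ = S → F (Z + toC S) = F Z)
    {Z : Matrix (Fin n) (Fin n) ℂ} (hZ : Z ∈ upperHalfSpace n) :
    HasSum (fun T : halfIntegral n => fourierCoeff F T.1 * qPow T.1 Z) (F Z) := by
  obtain ⟨z, rfl⟩ := exists_symMat hZ.1
  have hdiff : DifferentiableOn ℂ (fun z => F (symMat z)) (TubeFourier.tube (posCone n)) := by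
    let L : (Sym2 (Fin n) → ℂ) →ₗ[ℂ] Matrix (Fin n) (Fin n) ℂ :=
      { toFun := symMat, map_add' := fun _ _ => rfl, map_smul' := fun _ _ => rfl }
    have hL : Continuous L := continuous_matrix fun a b => continuous_apply _
    exact differentiableOn_comp_clm hF ⟨L, hL⟩ fun z hz => mem_tube_iff.1 hz
  have h := TubeFourier.hasSum_coeff isOpen_posCone convex_posCone hdiff (fun w hw m => by
    have := hper _ (mem_tube_iff.1 hw) (symMat m) (symMat_transpose m)
    rw [← this]
    rfl) oneCoord_mem (mem_tube_iff.2 hZ)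
  simp only [coeff_eq_fourierCoeff, expo_eq_qPow] at h
  exact (Equiv.ofBijective _ halfMat_bijective).hasSum_iff.1 h

/-- A modular form for a group that contains `Γ_1(N)` is invariant under integral translations. -/
lemma IsModularForm.translate {k N : ℕ} {Γ : Set (ModularGroup n)} {χ : DirichletCharacter ℂ N}
    {F : Matrix (Fin n) (Fin n) ℂ → ℂ} (hF : IsModularForm k N Γ χ F) (hΓ : Gamma1 n N ⊆ Γ)
    {Z : Matrix (Fin n) (Fin n) ℂ} (hZ : Z ∈ upperHalfSpace n) {S : Matrix (Fin n) (Fin n) ℤ}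
    (hS : Sᵀ = S) : F (Z + toC S) = F Z := by
  have hmem : fromBlocks 1 S 0 1 ∈ symplecticGroup (Fin n) ℤ := by
    rw [SymplecticGroup.fromBlocks_mem_iff]; simp [hS]
  have hA : blockA ⟨_, hmem⟩ = 1 := toBlocks_fromBlocks₁₁ _ _ _ _
  have hB : blockB ⟨_, hmem⟩ = S := toBlocks_fromBlocks₁₂ _ _ _ _
  have hC : blockC ⟨_, hmem⟩ = 0 := toBlocks_fromBlocks₂₁ _ _ _ _
  have hD : blockD ⟨_, hmem⟩ = 1 := toBlocks_fromBlocks₂₂ _ _ _ _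
  have h0 : toC (0 : Matrix (Fin n) (Fin n) ℤ) = 0 := Matrix.map_zero _ Int.cast_zero
  have hden : denom ⟨_, hmem⟩ Z = 1 := by
    change toC (blockC ⟨_, hmem⟩) * Z + toC (blockD ⟨_, hmem⟩) = 1
    rw [hC, hD, toC_one, h0, Matrix.zero_mul, zero_add]
  have hmoe : moebius ⟨_, hmem⟩ Z = Z + toC S := by
    rw [moebius_eq, hden, numer, hA, hB, toC_one]
    simp
  have h := hF.slash_eq ⟨_, hmem⟩ (hΓ ⟨fun a b => by rw [hC], fun a b => by rw [hA],
    fun a b => by rw [hD]⟩) Z hZ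
  rw [slash, hden, hmoe, hD] at h
  simpa using h

end Siegel

/-! ### Congruence conditions on minors -/

namespace Siegel

variable {n : ℕ}

/-- In characteristic two, a symmetric matrix of odd size with zero diagonal has determinant
zero: in the Leibniz formula `σ` and `σ⁻¹` contribute equally, and an involution of a set of odd
cardinality has a fixed point. -/
lemma det_eq_zero_of_alternating {R m : Type*} [CommRing R] [Fintype m] [DecidableEq m]
    (h2 : (2 : R) = 0) (hodd : Odd (Fintype.card m)) {A : Matrix m m R} (hA : Aᵀ = A)
    (hd : ∀ i, A i i = 0) : A.det = 0 := by
  rw [det_apply]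
  refine Finset.sum_involution (fun σ _ => σ⁻¹) (fun σ _ => ?_) (fun σ _ hσ h => hσ ?_)
    (fun σ _ => Finset.mem_univ _) (fun σ _ => inv_inv σ)
  · have h1 : ∏ i, A (σ⁻¹ i) i = ∏ i, A (σ i) i := by
      rw [← Equiv.prod_comp σ]
      refine Finset.prod_congr rfl fun i _ => ?_
      have h : σ⁻¹ (σ i) = i := σ.symm_apply_apply i
      rw [h]
      exact congrFun (congrFun hA _) _
    rw [h1, Equiv.Perm.sign_inv, ← two_smul R, h2, zero_smul]
  · have hsq : σ ^ 2 ^ 1 = 1 := by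
      rw [pow_one, sq]
      nth_rewrite 1 [← h]
      exact inv_mul_cancel σ
    have := Fact.mk Nat.prime_two
    obtain ⟨i, hi⟩ := Equiv.Perm.exists_fixed_point_of_prime (p := 2)
      (by rwa [← even_iff_two_dvd, Nat.not_even_iff_odd]) hsq
    rw [Finset.prod_eq_zero (Finset.mem_univ i) (by rw [hi, hd]), smul_zero]

/-- The determinant of an even symmetric integral matrix of odd size is even, and half of it
depends polynomially on the entries, so it respects congruences. -/
lemma two_mul_dvd_det_sub {j M : ℕ} (hj : Odd j) {G K : Matrix (Fin j) (Fin j) ℤ}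
    (hG : Gᵀ = G) (hK : Kᵀ = K) (hGd : ∀ i, 2 ∣ G i i) (hKd : ∀ i, 2 ∣ K i i) :
    (2 * M : ℤ) ∣ (G + (M : ℤ) • K).det - G.det := by
  set P : Matrix (Fin j) (Fin j) (Polynomial ℤ) :=
    G.map Polynomial.C + (Polynomial.X : Polynomial ℤ) • K.map Polynomial.C with hP
  have heval : ∀ m : ℤ, P.det.eval m = (G + m • K).det := by
    intro m
    rw [← Polynomial.coe_evalRingHom, RingHom.map_det]
    congr 1
    ext a b
    simp only [hP, RingHom.mapMatrix_apply, map_apply, Matrix.add_apply, Matrix.smul_apply,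
      smul_eq_mul, Polynomial.coe_evalRingHom, Polynomial.eval_add, Polynomial.eval_mul,
      Polynomial.eval_C, Polynomial.eval_X]
  have hmod : P.det.map (Int.castRingHom (ZMod 2)) = 0 := by
    have h0 : ∀ x : ℤ, 2 ∣ x → (x : ZMod 2) = 0 := fun x hx =>
      (ZMod.intCast_zmod_eq_zero_iff_dvd x 2).2 hx
    rw [← Polynomial.coe_mapRingHom, RingHom.map_det]
    refine det_eq_zero_of_alternating ?_ (by simpa using hj) ?_ fun i => ?_
    · exact CharTwo.two_eq_zero
    · ext1 a b
      have h1 : G b a = G a b := congrFun (congrFun hG a) b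
      have h2 : K b a = K a b := congrFun (congrFun hK a) b
      simp only [hP, transpose_apply, RingHom.mapMatrix_apply, map_apply, Matrix.add_apply,
        Matrix.smul_apply, h1, h2]
    · simp only [hP, RingHom.mapMatrix_apply, map_apply, Matrix.add_apply, Matrix.smul_apply,
        smul_eq_mul, Polynomial.coe_mapRingHom, Polynomial.map_add, Polynomial.map_mul,
        Polynomial.map_C, Int.coe_castRingHom, h0 _ (hGd i), h0 _ (hKd i), map_zero, mul_zero,
        add_zero]
  have hdvd : Polynomial.C (2 : ℤ) ∣ P.det := by
    rw [Polynomial.C_dvd_iff_dvd_coeff]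
    intro i
    rw [show (2 : ℤ) = ((2 : ℕ) : ℤ) from rfl, ← ZMod.intCast_zmod_eq_zero_iff_dvd]
    have := congrArg (fun p => Polynomial.coeff p i) hmod
    simpa using this
  obtain ⟨q, hq⟩ := hdvd
  have h1 := heval M
  have h0 := heval 0
  rw [zero_smul, add_zero] at h0
  rw [← h1, ← h0, hq, Polynomial.eval_mul, Polynomial.eval_mul, Polynomial.eval_C,
    Polynomial.eval_C, ← mul_sub]
  refine mul_dvd_mul_left _ ?_
  simpa using Polynomial.sub_dvd_eval_sub (M : ℤ) 0 q

lemma dvd_det_sub {m : Type*} [Fintype m] [DecidableEq m] (M : ℕ) (G K : Matrix m m ℤ) :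
    (M : ℤ) ∣ (G + (M : ℤ) • K).det - G.det := by
  rw [← ZMod.intCast_zmod_eq_zero_iff_dvd, Int.cast_sub, sub_eq_zero]
  change Int.castRingHom (ZMod M) _ = Int.castRingHom (ZMod M) _
  rw [RingHom.map_det, RingHom.map_det]
  congr 1
  ext a b
  simp only [RingHom.mapMatrix_apply, map_apply, Matrix.add_apply, Matrix.smul_apply, smul_eq_mul,
    map_add, map_mul, eq_intCast, Int.cast_natCast, ZMod.natCast_self, zero_mul, add_zero]

/-- A double sum of a symmetric function lies in a subgroup if the diagonal terms and twice the
off-diagonal terms do. -/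
lemma sum_sum_mem_of_symm {κ V : Type*} [AddCommGroup V] (H : AddSubgroup V) (φ : κ → κ → V)
    (hφ : ∀ a b, φ a b = φ b a) (hd : ∀ a, φ a a ∈ H) (ho : ∀ a b, (2 : ℤ) • φ a b ∈ H)
    (s : Finset κ) : ∑ a ∈ s, ∑ b ∈ s, φ a b ∈ H := by
  classical
  induction s using Finset.induction_on with
  | empty => simp
  | insert a s ha ih =>
    have h1 : ∑ x ∈ insert a s, ∑ y ∈ insert a s, φ x y
        = φ a a + ∑ b ∈ s, (2 : ℤ) • φ a b + ∑ x ∈ s, ∑ y ∈ s, φ x y := by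
      simp only [Finset.sum_insert ha, Finset.sum_add_distrib, two_smul]
      rw [Finset.sum_congr rfl fun b _ => hφ b a]
      abel
    rw [h1]
    exact H.add_mem (H.add_mem (hd a) (H.sum_mem fun b _ => ho a b)) ih

lemma det_mul_expand {R : Type*} [CommRing R] {j : ℕ} (X : Matrix (Fin j) (Fin n) R)
    (B : Matrix (Fin n) (Fin j) R) :
    (X * B).det = ∑ f : Fin j → Fin n, (∏ i, X i (f i)) * (B.submatrix f id).det := by
  have h1 : (X * B) = fun i => ∑ k, X i k • B k := by
    ext i l
    simp [mul_apply]
  change detRowAlternating.toMultilinearMap (X * B) = _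
  rw [h1, MultilinearMap.map_sum]
  refine Finset.sum_congr rfl fun f _ => ?_
  rw [MultilinearMap.map_smul_univ, smul_eq_mul]
  rfl

/-- The Cauchy–Binet expansion, over all pairs of index functions. -/
lemma det_mul_mul_transpose_expand {R : Type*} [CommRing R] {j : ℕ}
    (X Y : Matrix (Fin j) (Fin n) R) (T : Matrix (Fin n) (Fin n) R) :
    (X * T * Yᵀ).det = ∑ f : Fin j → Fin n, ∑ g : Fin j → Fin n,
      ((∏ i, X i (f i)) * ∏ i, Y i (g i)) * (T.submatrix f g).det := by
  rw [Matrix.mul_assoc, det_mul_expand]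
  refine Finset.sum_congr rfl fun f _ => ?_
  have h1 : ((T * Yᵀ).submatrix f id).det = (Y * (T.submatrix f id)ᵀ).det := by
    rw [← det_transpose]
    congr 1
    ext a b
    simp [mul_apply, mul_comm]
  rw [h1, det_mul_expand, Finset.mul_sum]
  refine Finset.sum_congr rfl fun g _ => ?_
  rw [← det_transpose (T.submatrix f g), mul_assoc]
  rfl

/-- An injective index function is an increasing one up to a permutation. -/
lemma exists_orderEmbedding_comp {j : ℕ} {f : Fin j → Fin n} (hf : Function.Injective f) :
    ∃ (I : Fin j ↪o Fin n) (σ : Equiv.Perm (Fin j)), f = I ∘ σ := by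
  have hcard : (Finset.univ.image f).card = j := by
    rw [Finset.card_image_of_injective _ hf, Finset.card_univ, Fintype.card_fin]
  set I := (Finset.univ.image f).orderEmbOfFin hcard
  have hmem : ∀ i, ∃ l, I l = f i := by
    intro i
    have : f i ∈ Set.range I := by
      rw [Finset.range_orderEmbOfFin]
      simp
    exact this
  choose σ hσ using hmem
  have hinj : Function.Injective σ := fun a b hab => hf <| by rw [← hσ a, ← hσ b, hab]
  exact ⟨I, Equiv.ofBijective σ (Finite.injective_iff_bijective.1 hinj), funext fun i => (hσ i).symm⟩

/-- `T^{[j]} ≡ 0 mod M`, expressed by the minors of all products `X T Yᵀ` with integral `X`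
and `Y`. This form makes the invariance under unimodular transformations visible. -/
def FormsModZero (j M : ℕ) (T : Matrix (Fin n) (Fin n) ℚ) : Prop :=
  (∀ X Y : Matrix (Fin j) (Fin n) ℤ, (2 : ℚ) ^ j *
    (X.map (Int.cast : ℤ → ℚ) * T * (Y.map (Int.cast : ℤ → ℚ))ᵀ).det
      ∈ AddSubgroup.zmultiples (M : ℚ)) ∧
  (Odd j → ∀ X : Matrix (Fin j) (Fin n) ℤ, (2 : ℚ) ^ (j - 1) *
    (X.map (Int.cast : ℤ → ℚ) * T * (X.map (Int.cast : ℤ → ℚ))ᵀ).det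
      ∈ AddSubgroup.zmultiples (M : ℚ))

lemma minorsModZero_iff_mem {j M : ℕ} {T : Matrix (Fin n) (Fin n) ℚ} :
    MinorsModZero j M T ↔ ∀ I J : Fin j ↪o Fin n,
      (minorDenom I J : ℚ) * (T.submatrix I J).det ∈ AddSubgroup.zmultiples (M : ℚ) := by
  refine forall₂_congr fun I J => ?_
  rw [AddSubgroup.mem_zmultiples_iff]
  refine exists_congr fun m => ?_
  rw [zsmul_eq_mul, mul_comm (m : ℚ), eq_comm]
  rfl

lemma two_pow_eq_of_odd {j : ℕ} (hj : Odd j) : (2 : ℚ) ^ j = 2 * 2 ^ (j - 1) := by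
  rw [← pow_succ', Nat.sub_add_cancel hj.pos]

lemma minor_mem_of_minorsModZero {j M : ℕ} {T : Matrix (Fin n) (Fin n) ℚ}
    (h : MinorsModZero j M T) (f g : Fin j → Fin n) :
    (2 : ℚ) ^ j * (T.submatrix f g).det ∈ AddSubgroup.zmultiples (M : ℚ) ∧
    (Odd j → (2 : ℚ) ^ (j - 1) * (T.submatrix f f).det ∈ AddSubgroup.zmultiples (M : ℚ)) := by
  rw [minorsModZero_iff_mem] at h
  have hzero : ∀ f g : Fin j → Fin n, ¬ Function.Injective f → (T.submatrix f g).det = 0 := by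
    intro f g hf
    simp only [Function.Injective, not_forall] at hf
    obtain ⟨a, b, hab, hne⟩ := hf
    exact det_zero_of_row_eq hne (by ext l; simp [hab])
  constructor
  · by_cases hf : Function.Injective f
    swap
    · rw [hzero f g hf, mul_zero]; exact zero_mem _
    by_cases hg : Function.Injective g
    swap
    · rw [← det_transpose, transpose_submatrix]
      have h0 : (Tᵀ.submatrix g f).det = 0 := by
        simp only [Function.Injective, not_forall] at hg
        obtain ⟨a, b, hab, hne⟩ := hg
        exact det_zero_of_row_eq hne (by ext l; simp [hab])
      rw [h0, mul_zero]; exact zero_mem _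
    obtain ⟨I, σ, rfl⟩ := exists_orderEmbedding_comp hf
    obtain ⟨J, τ, rfl⟩ := exists_orderEmbedding_comp hg
    have h1 : (T.submatrix (I ∘ σ) (J ∘ τ)).det
        = (Equiv.Perm.sign σ : ℤ) * ((Equiv.Perm.sign τ : ℤ) * (T.submatrix I J).det) := by
      rw [← det_permute', ← det_permute]
      rfl
    have h2 : (2 : ℚ) ^ j * (T.submatrix I J).det ∈ AddSubgroup.zmultiples (M : ℚ) := by
      have := h I J
      rw [minorDenom] at this
      split_ifs at this with hc
      · rw [two_pow_eq_of_odd hc.2]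
        have h3 := AddSubgroup.zsmul_mem _ this 2
        push_cast [zsmul_eq_mul] at h3
        rwa [← mul_assoc] at h3
      · exact_mod_cast this
    have h3 := AddSubgroup.zsmul_mem _ h2 ((Equiv.Perm.sign σ : ℤ) * (Equiv.Perm.sign τ : ℤ))
    rw [h1]
    convert h3 using 1
    rw [zsmul_eq_mul]
    push_cast
    ring
  · intro hj
    by_cases hf : Function.Injective f
    swap
    · rw [hzero f f hf, mul_zero]; exact zero_mem _
    obtain ⟨I, σ, rfl⟩ := exists_orderEmbedding_comp hf
    have h1 : (T.submatrix (I ∘ σ) (I ∘ σ)).det = (T.submatrix I I).det := by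
      rw [← det_submatrix_equiv_self σ (T.submatrix I I)]
      rfl
    have := h I I
    rw [minorDenom, if_pos ⟨rfl, hj⟩] at this
    rw [h1]
    exact_mod_cast this

lemma minorsModZero_iff {j M : ℕ} {T : Matrix (Fin n) (Fin n) ℚ} (hT : Tᵀ = T) :
    MinorsModZero j M T ↔ FormsModZero j M T := by
  constructor
  · intro h
    have hm := minor_mem_of_minorsModZero h
    have hscale : ∀ (X Y : Matrix (Fin j) (Fin n) ℤ) (f g : Fin j → Fin n) (q : ℚ) (e : ℕ),
        (2 : ℚ) ^ e * q ∈ AddSubgroup.zmultiples (M : ℚ) →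
        (2 : ℚ) ^ e * (((∏ i, X.map (Int.cast : ℤ → ℚ) i (f i)) *
          ∏ i, Y.map (Int.cast : ℤ → ℚ) i (g i)) * q) ∈ AddSubgroup.zmultiples (M : ℚ) := by
      intro X Y f g q e hq
      convert AddSubgroup.zsmul_mem _ hq ((∏ i, X i (f i)) * ∏ i, Y i (g i)) using 1
      rw [zsmul_eq_mul]
      push_cast
      simp only [map_apply]
      ring
    refine ⟨fun X Y => ?_, fun hj X => ?_⟩
    · rw [det_mul_mul_transpose_expand, Finset.mul_sum]
      refine AddSubgroup.sum_mem _ fun f _ => ?_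
      rw [Finset.mul_sum]
      exact AddSubgroup.sum_mem _ fun g _ => hscale X Y f g _ _ (hm f g).1
    · rw [det_mul_mul_transpose_expand, Finset.mul_sum]
      simp only [Finset.mul_sum]
      refine sum_sum_mem_of_symm _ _ (fun f g => ?_) (fun f => ?_) (fun f g => ?_) _
      · rw [← det_transpose (T.submatrix g f), transpose_submatrix, hT]
        ring
      · exact hscale X X f f _ _ ((hm f f).2 hj)
      · have := hscale X X f g _ _ (hm f g).1
        rw [two_pow_eq_of_odd hj, mul_assoc] at this
        simpa using this
  · rintro ⟨h1, h2⟩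
    rw [minorsModZero_iff_mem]
    intro I J
    have hsel : ∀ I J : Fin j ↪o Fin n,
        ((1 : Matrix (Fin n) (Fin n) ℤ).submatrix I id).map (Int.cast : ℤ → ℚ) * T *
        (((1 : Matrix (Fin n) (Fin n) ℤ).submatrix J id).map (Int.cast : ℤ → ℚ))ᵀ
        = T.submatrix I J := by
      intro I J
      ext a b
      simp [mul_apply, one_apply]
    rw [minorDenom]
    split_ifs with hc
    · obtain ⟨rfl, hj⟩ := hc
      have := h2 hj ((1 : Matrix (Fin n) (Fin n) ℤ).submatrix I id)
      rw [hsel] at this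
      exact_mod_cast this
    · have := h1 ((1 : Matrix (Fin n) (Fin n) ℤ).submatrix I id)
        ((1 : Matrix (Fin n) (Fin n) ℤ).submatrix J id)
      rw [hsel] at this
      exact_mod_cast this

/-- The entrywise inclusion of integral matrices into rational matrices. -/
abbrev toQ (X : Matrix (Fin n) (Fin n) ℤ) : Matrix (Fin n) (Fin n) ℚ :=
  X.map (Int.cast : ℤ → ℚ)

lemma toQ_mul (X Y : Matrix (Fin n) (Fin n) ℤ) : toQ (X * Y) = toQ X * toQ Y :=
  Matrix.map_mul (f := Int.castRingHom ℚ)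

lemma FormsModZero.conj {j M : ℕ} {T : Matrix (Fin n) (Fin n) ℚ} (h : FormsModZero j M T)
    (D : Matrix (Fin n) (Fin n) ℤ) : FormsModZero j M (toQ D * T * (toQ D)ᵀ) := by
  have key : ∀ X Y : Matrix (Fin j) (Fin n) ℤ,
      X.map (Int.cast : ℤ → ℚ) * (toQ D * T * (toQ D)ᵀ) * (Y.map (Int.cast : ℤ → ℚ))ᵀ
      = (X * D).map (Int.cast : ℤ → ℚ) * T * ((Y * D).map (Int.cast : ℤ → ℚ))ᵀ := by
    intro X Y
    have h1 : ∀ X : Matrix (Fin j) (Fin n) ℤ, (X * D).map (Int.cast : ℤ → ℚ)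
        = X.map (Int.cast : ℤ → ℚ) * toQ D := fun X => Matrix.map_mul (f := Int.castRingHom ℚ)
    rw [h1, h1, transpose_mul]
    simp only [Matrix.mul_assoc]
  refine ⟨fun X Y => ?_, fun hj X => ?_⟩
  · rw [key]; exact h.1 _ _
  · rw [key]; exact h.2 hj _

lemma exists_two_smul_eq {T : Matrix (Fin n) (Fin n) ℚ} (hT : T ∈ halfIntegral n) :
    ∃ G : Matrix (Fin n) (Fin n) ℤ, Gᵀ = G ∧ (∀ a, 2 ∣ G a a) ∧ toQ G = (2 : ℚ) • T := by
  obtain ⟨hs, hd, ho⟩ := hT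
  obtain ⟨G, hG⟩ := Classical.skolem.1 fun a => Classical.skolem.1 (ho a)
  refine ⟨Matrix.of G, ?_, fun a => ?_, ?_⟩
  · ext a b
    have h := congrFun (congrFun hs a) b
    rw [transpose_apply] at h
    have h1 := hG b a
    rw [h, hG a b] at h1
    exact_mod_cast h1.symm
  · obtain ⟨m, hm⟩ := hd a
    refine ⟨m, ?_⟩
    have := hG a a
    rw [hm] at this
    exact_mod_cast this.symm
  · ext a b
    simp [hG]

/-- The condition `T^{[j]} ≡ 0 mod M` only depends on `T` modulo `M Λ_n`. -/
lemma MinorsModZero.add_smul {j M : ℕ} {T E : Matrix (Fin n) (Fin n) ℚ}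
    (hT : T ∈ halfIntegral n) (hE : E ∈ halfIntegral n) (h : MinorsModZero j M T) :
    MinorsModZero j M (T + (M : ℚ) • E) := by
  rw [minorsModZero_iff_mem] at *
  intro I J
  obtain ⟨G, hGs, hGd, hG⟩ := exists_two_smul_eq hT
  obtain ⟨K, hKs, hKd, hK⟩ := exists_two_smul_eq hE
  have hdet : ∀ (S : Matrix (Fin n) (Fin n) ℚ) (L : Matrix (Fin j) (Fin j) ℤ),
      (2 : ℚ) • S.submatrix I J = L.map (Int.cast : ℤ → ℚ) →
      (2 : ℚ) ^ j * (S.submatrix I J).det = (L.det : ℤ) := by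
    intro S L hSL
    have h1 : ((L.det : ℤ) : ℚ) = (L.map (Int.cast : ℤ → ℚ)).det :=
      RingHom.map_det (Int.castRingHom ℚ) L
    rw [h1, ← hSL, det_smul, Fintype.card_fin]
  have hTd := hdet T (G.submatrix I J) (by
    ext a b
    simpa using (congrFun (congrFun hG (I a)) (J b)).symm)
  have hTEd := hdet (T + (M : ℚ) • E) (G.submatrix I J + (M : ℤ) • K.submatrix I J) (by
    ext a b
    have h1 := congrFun (congrFun hG (I a)) (J b)
    have h2 := congrFun (congrFun hK (I a)) (J b)
    simp only [map_apply, Matrix.smul_apply, smul_eq_mul] at h1 h2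
    simp only [Matrix.smul_apply, submatrix_apply, Matrix.add_apply, map_apply, smul_eq_mul]
    push_cast
    rw [h1, h2]
    ring)
  have hIJ := h I J
  rw [minorDenom] at *
  rw [← sub_add_cancel ((_ : ℚ) * ((T + (M : ℚ) • E).submatrix I J).det)
    ((_ : ℚ) * (T.submatrix I J).det)]
  refine AddSubgroup.add_mem _ ?_ hIJ
  split_ifs with hc
  · obtain ⟨rfl, hj⟩ := hc
    obtain ⟨m, hm⟩ := two_mul_dvd_det_sub (M := M) hj (G := G.submatrix I I) (K := K.submatrix I I)
      (by rw [transpose_submatrix, hGs]) (by rw [transpose_submatrix, hKs]) (fun i => hGd _)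
      (fun i => hKd _)
    rw [AddSubgroup.mem_zmultiples_iff]
    refine ⟨m, ?_⟩
    rw [two_pow_eq_of_odd hj] at hTd hTEd
    have hm' : (((G.submatrix I I + (M : ℤ) • K.submatrix I I).det : ℤ) : ℚ)
        - ((G.submatrix I I).det : ℤ) = 2 * M * m := by exact_mod_cast hm
    rw [← hTd, ← hTEd] at hm'
    rw [zsmul_eq_mul]
    push_cast
    linarith
  · obtain ⟨m, hm⟩ := dvd_det_sub M (G.submatrix I J) (K.submatrix I J)
    rw [AddSubgroup.mem_zmultiples_iff]
    refine ⟨m, ?_⟩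
    have hm' : (((G.submatrix I J + (M : ℤ) • K.submatrix I J).det : ℤ) : ℚ)
        - ((G.submatrix I J).det : ℤ) = M * m := by exact_mod_cast hm
    rw [← hTd, ← hTEd] at hm'
    rw [zsmul_eq_mul]
    push_cast
    linarith

lemma halfIntegral_neg {T : Matrix (Fin n) (Fin n) ℚ} (hT : T ∈ halfIntegral n) :
    -T ∈ halfIntegral n := by
  obtain ⟨hs, hd, ho⟩ := hT
  refine ⟨by rw [IsSymm, transpose_neg, hs], fun a => ?_, fun a b => ?_⟩
  · obtain ⟨m, hm⟩ := hd a
    exact ⟨-m, by simp [hm]⟩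
  · obtain ⟨m, hm⟩ := ho a b
    exact ⟨-m, by simp [hm]⟩

lemma halfIntegral_add {T E : Matrix (Fin n) (Fin n) ℚ} (hT : T ∈ halfIntegral n)
    (hE : E ∈ halfIntegral n) : T + E ∈ halfIntegral n := by
  obtain ⟨hs, hd, ho⟩ := hT
  obtain ⟨hs', hd', ho'⟩ := hE
  refine ⟨by rw [IsSymm, transpose_add, hs, hs'], fun a => ?_, fun a b => ?_⟩
  · obtain ⟨m, hm⟩ := hd a
    obtain ⟨m', hm'⟩ := hd' a
    exact ⟨m + m', by simp [hm, hm']⟩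
  · obtain ⟨m, hm⟩ := ho a b
    obtain ⟨m', hm'⟩ := ho' a b
    exact ⟨m + m', by simp [mul_add, hm, hm']⟩

lemma halfIntegral_natCast_smul {T : Matrix (Fin n) (Fin n) ℚ} (hT : T ∈ halfIntegral n) (M : ℕ) :
    (M : ℚ) • T ∈ halfIntegral n := by
  obtain ⟨hs, hd, ho⟩ := hT
  refine ⟨by rw [IsSymm, transpose_smul, hs], fun a => ?_, fun a b => ?_⟩
  · obtain ⟨m, hm⟩ := hd a
    exact ⟨M * m, by simp [hm]⟩
  · obtain ⟨m, hm⟩ := ho a b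
    exact ⟨M * m, by rw [Matrix.smul_apply, smul_eq_mul, mul_left_comm, hm]; push_cast; rfl⟩

/-- `Λ_n` is stable under `T ↦ X T Xᵀ` for integral `X`. -/
lemma halfIntegral_conj {T : Matrix (Fin n) (Fin n) ℚ} (hT : T ∈ halfIntegral n)
    (X : Matrix (Fin n) (Fin n) ℤ) : toQ X * T * (toQ X)ᵀ ∈ halfIntegral n := by
  obtain ⟨G, hGs, hGd, hG⟩ := exists_two_smul_eq hT
  have h2 : toQ (X * G * Xᵀ) = (2 : ℚ) • (toQ X * T * (toQ X)ᵀ) := by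
    rw [toQ_mul, toQ_mul, hG, Matrix.mul_smul, Matrix.smul_mul]
    rfl
  refine ⟨?_, fun a => ?_, fun a b => ?_⟩
  · rw [IsSymm, transpose_mul, transpose_mul, transpose_transpose, hT.1, Matrix.mul_assoc]
  · have hmem : (X * G * Xᵀ) a a ∈ AddSubgroup.zmultiples (2 : ℤ) := by
      have : (X * G * Xᵀ) a a = ∑ b, ∑ c, X a b * G b c * X a c := by
        simp only [mul_apply, transpose_apply, Finset.sum_mul]
        exact Finset.sum_comm
      rw [this]
      refine sum_sum_mem_of_symm _ _ (fun b c => ?_) (fun b => ?_) (fun b c => ?_) _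
      · have : G b c = G c b := congrFun (congrFun hGs c) b
        rw [this]; ring
      · rw [Int.mem_zmultiples_iff]
        exact ((hGd b).mul_left _).mul_right _
      · rw [Int.mem_zmultiples_iff]
        exact dvd_mul_right _ _
    obtain ⟨m, hm⟩ := Int.mem_zmultiples_iff.1 hmem
    refine ⟨m, ?_⟩
    have h3 : (((X * G * Xᵀ) a a : ℤ) : ℚ) = 2 * (toQ X * T * (toQ X)ᵀ) a a :=
      congrFun (congrFun h2 a) a
    rw [hm] at h3
    push_cast at h3
    linarith
  · exact ⟨(X * G * Xᵀ) a b, (congrFun (congrFun h2 a) b).symm⟩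

/-- `X T + (X T)ᵀ` lies in `Λ_n` for integral `X` and `T ∈ Λ_n`. -/
lemma halfIntegral_mul_add_transpose {T : Matrix (Fin n) (Fin n) ℚ} (hT : T ∈ halfIntegral n)
    (X : Matrix (Fin n) (Fin n) ℤ) : toQ X * T + (toQ X * T)ᵀ ∈ halfIntegral n := by
  obtain ⟨G, hGs, hGd, hG⟩ := exists_two_smul_eq hT
  have h2 : toQ (X * G) = (2 : ℚ) • (toQ X * T) := by
    rw [toQ_mul, hG, Matrix.mul_smul]
  have h3 : ∀ a b, (2 : ℚ) * (toQ X * T) a b = (X * G) a b :=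
    fun a b => (congrFun (congrFun h2 a) b).symm
  refine ⟨?_, fun a => ⟨(X * G) a a, ?_⟩, fun a b => ⟨(X * G) a b + (X * G) b a, ?_⟩⟩
  · rw [IsSymm, transpose_add, transpose_transpose, add_comm]
  · rw [← h3, Matrix.add_apply, transpose_apply, two_mul]
  · push_cast
    rw [← h3, ← h3, Matrix.add_apply, transpose_apply, mul_add]

/-- The condition `T^{[j]} ≡ 0 mod M` is invariant under `T ↦ D T Dᵀ` for integral matrices `D`
that are invertible modulo `M`. -/
lemma minorsModZero_conj_iff {j M : ℕ} {T : Matrix (Fin n) (Fin n) ℚ} (hT : T ∈ halfIntegral n)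
    {D D' E : Matrix (Fin n) (Fin n) ℤ} (hD : D' * D = 1 + (M : ℤ) • E) :
    MinorsModZero j M (toQ D * T * (toQ D)ᵀ) ↔ MinorsModZero j M T := by
  have hDT := halfIntegral_conj hT D
  rw [minorsModZero_iff hDT.1]
  refine ⟨fun h => ?_, fun h => ((minorsModZero_iff hT.1).1 h).conj D⟩
  have h1 := h.conj D'
  have hQ : toQ (D' * D) = 1 + (M : ℚ) • toQ E := by
    rw [hD]
    ext a b
    simp only [map_apply, Matrix.add_apply, Matrix.smul_apply, smul_eq_mul, one_apply]
    push_cast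
    split_ifs <;> simp
  set S := (toQ E * T + (toQ E * T)ᵀ) + (M : ℚ) • (toQ E * T * (toQ E)ᵀ)
  have hS : S ∈ halfIntegral n := halfIntegral_add (halfIntegral_mul_add_transpose hT E)
    (halfIntegral_natCast_smul (halfIntegral_conj hT E) M)
  have h2 : toQ D' * (toQ D * T * (toQ D)ᵀ) * (toQ D')ᵀ = T + (M : ℚ) • S := by
    have h3 : toQ D' * (toQ D * T * (toQ D)ᵀ) * (toQ D')ᵀ
        = toQ (D' * D) * T * (toQ (D' * D))ᵀ := by
      rw [toQ_mul, transpose_mul]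
      simp only [Matrix.mul_assoc]
    rw [h3, hQ]
    simp only [S, transpose_add, transpose_one, transpose_smul, transpose_mul, Matrix.add_mul,
      Matrix.mul_add, Matrix.one_mul, Matrix.mul_one, Matrix.smul_mul, Matrix.mul_smul, smul_add,
      hT.1.eq]
    abel
  have hTS := halfIntegral_add hT (halfIntegral_natCast_smul hS M)
  rw [h2, ← minorsModZero_iff hTS.1] at h1
  have h4 := h1.add_smul hTS (halfIntegral_neg hS)
  rwa [smul_neg, add_neg_cancel_right] at h4

end Siegel

/-! ### The operator as a combination of translates -/

namespace Siegel

variable {n : ℕ}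

/-- Orthogonality of the additive characters modulo `M`. -/
lemma sum_zpow_eq_ite {M : ℕ} {ζ : ℂ} (hζ : IsPrimitiveRoot ζ M) (d : ℤ) :
    ∑ u : Fin M, ζ ^ (d * (u : ℤ)) = if (M : ℤ) ∣ d then (M : ℂ) else 0 := by
  have h1 : ∀ u : Fin M, ζ ^ (d * (u : ℤ)) = (ζ ^ d) ^ (u : ℕ) := fun u => by
    rw [_root_.zpow_mul, zpow_natCast]
  simp only [h1]
  rw [Fin.sum_univ_eq_sum_range (fun u => (ζ ^ d) ^ u) M]
  split_ifs with h
  · rw [(hζ.zpow_eq_one_iff_dvd d).2 h]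
    simp
  · have hne : ζ ^ d ≠ 1 := fun h' => h ((hζ.zpow_eq_one_iff_dvd d).1 h')
    rw [geom_sum_eq hne, ← zpow_natCast, ← _root_.zpow_mul, mul_comm, _root_.zpow_mul, zpow_natCast,
      hζ.pow_eq_one, _root_.one_zpow, sub_self, zero_div]

/-- A function on `ℤ^ι` that is periodic modulo `M` is a combination of additive characters
modulo `M`. -/
lemma exists_character_expansion {ι : Type*} [Fintype ι] [DecidableEq ι] {M : ℕ}
    (hM : 0 < M) {ζ : ℂ} (hζ : IsPrimitiveRoot ζ M) (φ : (ι → ℤ) → ℂ)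
    (hφ : ∀ t u : ι → ℤ, φ (t + fun i => M * u i) = φ t) :
    ∃ c : (ι → Fin M) → ℂ, ∀ t, φ t = ∑ u, c u * ∏ i, ζ ^ (t i * (u i : ℤ)) := by
  have hζ0 : ζ ≠ 0 := hζ.ne_zero hM.ne'
  have hM0 : (M : ℂ) ≠ 0 := Nat.cast_ne_zero.2 hM.ne'
  refine ⟨fun u => ((M : ℂ) ^ Fintype.card ι)⁻¹ * ∑ r : ι → Fin M, φ (fun i => (r i : ℤ)) *
    ∏ i, ζ ^ (-((r i : ℤ) * (u i : ℤ))), fun t => ?_⟩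
  have horth : ∀ r : ι → Fin M, ∑ u : ι → Fin M, ∏ i, ζ ^ ((t i - (r i : ℤ)) * (u i : ℤ))
      = ∏ i, if (M : ℤ) ∣ t i - (r i : ℤ) then (M : ℂ) else 0 := by
    intro r
    rw [← Fintype.piFinset_univ,
      ← Finset.prod_univ_sum (fun _ : ι => (Finset.univ : Finset (Fin M)))
        (fun i u => ζ ^ ((t i - (r i : ℤ)) * (u : ℤ)))]
    exact Finset.prod_congr rfl fun i _ => sum_zpow_eq_ite hζ _
  have hswap : ∑ u : ι → Fin M, (((M : ℂ) ^ Fintype.card ι)⁻¹ * ∑ r : ι → Fin M,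
      φ (fun i => (r i : ℤ)) * ∏ i, ζ ^ (-((r i : ℤ) * (u i : ℤ)))) * ∏ i, ζ ^ (t i * (u i : ℤ))
      = ((M : ℂ) ^ Fintype.card ι)⁻¹ * ∑ r : ι → Fin M, φ (fun i => (r i : ℤ)) *
        ∏ i, if (M : ℤ) ∣ t i - (r i : ℤ) then (M : ℂ) else 0 := by
    simp only [← horth, Finset.mul_sum, Finset.sum_mul]
    rw [Finset.sum_comm]
    refine Finset.sum_congr rfl fun r _ => Finset.sum_congr rfl fun u _ => ?_
    rw [mul_assoc, mul_assoc, ← Finset.prod_mul_distrib]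
    congr 2
    refine Finset.prod_congr rfl fun i _ => ?_
    rw [← zpow_add₀ hζ0]
    congr 1
    ring
  rw [hswap]
  have hMZ : (M : ℤ) ≠ 0 := Int.natCast_ne_zero.2 hM.ne'
  have hlt : ∀ i, (t i % M).toNat < M := fun i => by
    have := Int.emod_nonneg (t i) hMZ
    have := Int.emod_lt_of_pos (t i) (Int.natCast_pos.2 hM)
    omega
  set r₀ : ι → Fin M := fun i => ⟨(t i % M).toNat, hlt i⟩
  have hr₀ : ∀ i, ((r₀ i : ℕ) : ℤ) = t i % M := fun i =>
    Int.toNat_of_nonneg (Int.emod_nonneg (t i) hMZ)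
  rw [Finset.sum_eq_single r₀]
  · have h1 : ∀ i, (M : ℤ) ∣ t i - (r₀ i : ℤ) := fun i => by
      rw [hr₀]; exact Int.dvd_self_sub_emod
    simp only [h1, if_true, Finset.prod_const, Finset.card_univ]
    have h2 : φ (fun i => ((r₀ i : ℕ) : ℤ)) = φ t := by
      rw [← hφ (fun i => ((r₀ i : ℕ) : ℤ)) fun i => t i / M]
      congr 1
      ext i
      simp only [Pi.add_apply, hr₀]
      exact Int.emod_add_mul_ediv _ _
    rw [h2]
    field_simp
  · intro r _ hr
    obtain ⟨i, hi⟩ := Function.ne_iff.1 hr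
    rw [Finset.prod_eq_zero (Finset.mem_univ i), mul_zero]
    rw [if_neg]
    intro hdvd
    apply hi
    have h1 : t i % M = (r i : ℤ) % M := (Int.modEq_iff_dvd.2 hdvd).symm
    have h2 : (r i : ℤ) % M = r i := Int.emod_eq_of_lt (by positivity) (by exact_mod_cast (r i).2)
    rw [h2, ← hr₀] at h1
    exact (Fin.ext (by exact_mod_cast h1)).symm
  · simp

lemma qPow_add (T : Matrix (Fin n) (Fin n) ℚ) (Z W : Matrix (Fin n) (Fin n) ℂ) :
    qPow T (Z + W) = qPow T Z * qPow T W := by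
  simp only [qPow, trace_add, mul_add, Complex.exp_add]

lemma halfMat_add_smul (t u : Sym2 (Fin n) → ℤ) (M : ℕ) :
    halfMat (t + fun i => M * u i) = halfMat t + (M : ℚ) • halfMat u := by
  ext a b
  simp only [halfMat, of_apply, Matrix.add_apply, Matrix.smul_apply, smul_eq_mul, Pi.add_apply]
  push_cast
  split_ifs <;> ring

open Classical in
/-- On `Λ_n` the indicator function of the condition `T^{[j]} ≡ 0 mod M` is a combination of the
characters `T ↦ exp(2πi tr(TS)/M)` with integral symmetric `S`. -/
lemma exists_indicator_expansion (n j : ℕ) {M : ℕ} (hM : 0 < M) :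
    ∃ (c : (Sym2 (Fin n) → Fin M) → ℂ) (S : (Sym2 (Fin n) → Fin M) → Matrix (Fin n) (Fin n) ℤ),
      (∀ u, (S u)ᵀ = S u) ∧ ∀ T ∈ halfIntegral n,
        (if MinorsModZero j M T then (1 : ℂ) else 0)
          = ∑ u, c u * qPow T ((M : ℂ)⁻¹ • toC (S u)) := by
  have hζ := Complex.isPrimitiveRoot_exp M hM.ne'
  obtain ⟨c, hc⟩ := exists_character_expansion (ι := Sym2 (Fin n)) hM hζ
    (fun t => if MinorsModZero j M (halfMat t) then (1 : ℂ) else 0) (fun t u => by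
      rw [halfMat_add_smul]
      congr 1
      rw [eq_iff_iff]
      refine ⟨fun h => ?_, fun h => h.add_smul (halfMat_mem t) (halfMat_mem u)⟩
      have h1 := h.add_smul (halfIntegral_add (halfMat_mem t)
        (halfIntegral_natCast_smul (halfMat_mem u) M)) (halfIntegral_neg (halfMat_mem u))
      rwa [smul_neg, add_neg_cancel_right] at h1)
  refine ⟨c, fun u => symMat fun s => ((u s : ℕ) : ℤ), fun u => symMat_transpose _, ?_⟩
  intro T hT
  obtain ⟨t, ht⟩ := halfMat_bijective.2 ⟨T, hT⟩
  obtain rfl : halfMat t = T := congrArg Subtype.val ht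
  rw [hc t]
  refine Finset.sum_congr rfl fun u _ => ?_
  congr 1
  have h1 : (M : ℂ)⁻¹ • toC (symMat fun s => ((u s : ℕ) : ℤ))
      = symMat fun s => (M : ℂ)⁻¹ * (u s : ℕ) := by
    ext a b
    simp only [Matrix.smul_apply, map_apply, symMat_apply, smul_eq_mul, Int.cast_natCast]
  rw [h1, ← expo_eq_qPow, TubeFourier.expo, Finset.mul_sum, Complex.exp_sum]
  refine Finset.prod_congr rfl fun s _ => ?_
  rw [← Complex.exp_int_mul]
  congr 1
  push_cast
  ring

lemma qPow_conj (T : Matrix (Fin n) (Fin n) ℚ) (D S : Matrix (Fin n) (Fin n) ℤ) (x : ℂ) :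
    qPow T (x • toC (Dᵀ * S * D)) = qPow (toQ D * T * (toQ D)ᵀ) (x • toC S) := by
  have hQ : ∀ X : Matrix (Fin n) (Fin n) ℤ, (toQ X).map (Rat.cast : ℚ → ℂ) = toC X := by
    intro X; ext; simp
  have hmul : ∀ X Y : Matrix (Fin n) (Fin n) ℚ, (X * Y).map (Rat.cast : ℚ → ℂ)
      = X.map (Rat.cast : ℚ → ℂ) * Y.map (Rat.cast : ℚ → ℂ) := fun X Y =>
    Matrix.map_mul (f := Rat.castHom ℂ)
  have hDt : ((toQ D)ᵀ).map (Rat.cast : ℚ → ℂ) = (toC D)ᵀ := by ext; simp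
  rw [qPow, qPow, hmul, hmul, hDt, hQ, toC_mul, toC_mul, toC_transpose]
  congr 2
  rw [Matrix.mul_smul, Matrix.mul_smul, trace_smul, trace_smul]
  congr 1
  rw [← Matrix.mul_assoc, trace_mul_comm]
  simp only [Matrix.mul_assoc]

/-- A translate by `S / M` with integral symmetric `S` stays in the upper half space. -/
lemma add_smul_toC_mem {Z : Matrix (Fin n) (Fin n) ℂ} (hZ : Z ∈ upperHalfSpace n) (M : ℕ)
    {S : Matrix (Fin n) (Fin n) ℤ} (hS : Sᵀ = S) :
    Z + (M : ℂ)⁻¹ • toC S ∈ upperHalfSpace n := by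
  refine add_mem_upperHalfSpace hZ ?_ fun a b => ?_
  · rw [transpose_smul, ← toC_transpose, hS]
  · have : ((M : ℂ)⁻¹ • toC S) a b = (((M : ℝ)⁻¹ * (S a b : ℝ) : ℝ) : ℂ) := by
      change (M : ℂ)⁻¹ * ((S a b : ℤ) : ℂ) = _
      push_cast
      rfl
    rw [this, Complex.ofReal_im]

lemma transpose_conj_eq {S : Matrix (Fin n) (Fin n) ℤ} (hS : Sᵀ = S)
    (D : Matrix (Fin n) (Fin n) ℤ) : (Dᵀ * S * D)ᵀ = Dᵀ * S * D := by
  rw [transpose_mul, transpose_mul, transpose_transpose, hS, Matrix.mul_assoc]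

/-- `F|A^{(j)}(M)` as a combination of translates of `F`. The translations may be twisted by any
matrix `D` that is invertible modulo `M`, as the condition on the minors is invariant under
`T ↦ D T Dᵀ`. -/
lemma hasSum_termA {j M : ℕ} {F : Matrix (Fin n) (Fin n) ℂ → ℂ}
    (hF : DifferentiableOn ℂ F (upperHalfSpace n))
    (hper : ∀ Z ∈ upperHalfSpace n, ∀ S : Matrix (Fin n) (Fin n) ℤ, Sᵀ = S → F (Z + toC S) = F Z)
    {κ : Type*} [Fintype κ] {c : κ → ℂ} {S : κ → Matrix (Fin n) (Fin n) ℤ}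
    (hS : ∀ u, (S u)ᵀ = S u)
    (hc : ∀ T ∈ halfIntegral n, (open Classical in if MinorsModZero j M T then (1 : ℂ) else 0)
      = ∑ u, c u * qPow T ((M : ℂ)⁻¹ • toC (S u)))
    {D D' E : Matrix (Fin n) (Fin n) ℤ} (hD : D' * D = 1 + (M : ℤ) • E)
    {Z : Matrix (Fin n) (Fin n) ℂ} (hZ : Z ∈ upperHalfSpace n) :
    HasSum (termA j M F Z) (∑ u, c u * F (Z + (M : ℂ)⁻¹ • toC (Dᵀ * S u * D))) := by
  have h1 : HasSum (fun T : halfIntegral n => ∑ u, c u *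
      (fourierCoeff F T.1 * qPow T.1 (Z + (M : ℂ)⁻¹ • toC (Dᵀ * S u * D))))
      (∑ u, c u * F (Z + (M : ℂ)⁻¹ • toC (Dᵀ * S u * D))) :=
    hasSum_sum fun u _ => (hasSum_fourierCoeff hF hper
      (add_smul_toC_mem hZ M (transpose_conj_eq (hS u) D))).mul_left _
  convert h1 using 1
  ext T
  have h2 := hc _ (halfIntegral_conj T.2 D)
  have hiff := minorsModZero_conj_iff (j := j) T.2 hD
  have h3 : ∀ u, c u * (fourierCoeff F T.1 * qPow T.1 (Z + (M : ℂ)⁻¹ • toC (Dᵀ * S u * D)))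
      = fourierCoeff F T.1 * qPow T.1 Z *
        (c u * qPow (toQ D * T.1 * (toQ D)ᵀ) ((M : ℂ)⁻¹ • toC (S u))) := by
    intro u
    rw [qPow_add, qPow_conj]
    ring
  simp only [h3]
  rw [← Finset.mul_sum, ← h2, termA]
  by_cases h : MinorsModZero j M T.1
  · rw [if_pos h, if_pos (hiff.2 h), mul_one]
  · rw [if_neg h, if_neg (mt hiff.1 h), mul_zero]

/-- Conjugation of `g ∈ Γ_0(N M²)` by translations by `S / M` and `DᵀSD / M`. -/
lemma exists_conj_Gamma0 {N M : ℕ} (hM : 0 < M) {g : ModularGroup n}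
    (hg : g ∈ Gamma0 n (N * M ^ 2)) {S : Matrix (Fin n) (Fin n) ℤ} (hS : Sᵀ = S) :
    ∃ g' : ModularGroup n, blockC g' = blockC g ∧ MatModEq N (blockA g') (blockA g) ∧
      MatModEq N (blockD g') (blockD g) ∧ ∀ Z ∈ upperHalfSpace n,
        denom g' (Z + (M : ℂ)⁻¹ • toC ((blockD g)ᵀ * S * blockD g)) = denom g Z ∧
        moebius g' (Z + (M : ℂ)⁻¹ • toC ((blockD g)ᵀ * S * blockD g))
          = moebius g Z + (M : ℂ)⁻¹ • toC S := by
  have hM0 : (M : ℂ) ≠ 0 := Nat.cast_ne_zero.2 hM.ne'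
  obtain ⟨C₁, hC₁⟩ : ∃ C₁ : Matrix (Fin n) (Fin n) ℤ,
      blockC g = ((N : ℤ) * M ^ 2) • C₁ := by
    have h : ∀ a b, ∃ m : ℤ, blockC g a b = ((N : ℤ) * M ^ 2) * m := fun a b => by
      have := Int.modEq_zero_iff_dvd.1 (hg a b)
      exact_mod_cast this
    obtain ⟨C₁, h⟩ := Classical.skolem.1 fun a => Classical.skolem.1 (h a)
    exact ⟨Matrix.of C₁, by ext a b; rw [h, Matrix.smul_apply, of_apply, smul_eq_mul]⟩
  have hAD := blockA_mul_transpose_blockD g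
  have hAD' : toC (blockA g) * (toC (blockD g))ᵀ
      = 1 + toC (blockB g) * (toC (blockC g))ᵀ := by
    have := congrArg toC (eq_add_of_sub_eq hAD)
    simpa only [toC_add, toC_mul, toC_transpose, toC_one] using this
  have hC₁' : toC (blockC g) = ((N : ℂ) * M ^ 2) • toC C₁ := by
    rw [hC₁, toC_smul]; push_cast; rfl
  set S' := (blockD g)ᵀ * S * blockD g with hS'def
  set s := (M : ℂ)⁻¹ • toC S with hs
  set s' := (M : ℂ)⁻¹ • toC S' with hs'
  have hsT : sᵀ = s := by rw [hs, transpose_smul, ← toC_transpose, hS]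
  have hs'T : s'ᵀ = s' := by rw [hs', transpose_smul, ← toC_transpose, transpose_conj_eq hS]
  have hA : toC (blockA g + ((N : ℤ) * M) • (S * C₁)) = toC (blockA g) + s * toC (blockC g) := by
    rw [toC_add, toC_smul, toC_mul, hC₁', hs, Matrix.smul_mul, Matrix.mul_smul, smul_smul]
    congr 2
    push_cast
    field_simp
  have hD : toC (blockD g - ((N : ℤ) * M) • (C₁ * S')) = toC (blockD g) - toC (blockC g) * s' := by
    rw [toC_sub, toC_smul, toC_mul, hC₁', hs', Matrix.smul_mul, Matrix.mul_smul, smul_smul]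
    congr 2
    push_cast
    field_simp
  have hB : toC (blockB g - ((N : ℤ) * M) • (blockB g * C₁ᵀ * S * blockD g)
      - (N : ℤ) • (S * C₁ * S')) = toC (blockB g) + s * toC (blockD g)
        - toC (blockA g + ((N : ℤ) * M) • (S * C₁)) * s' := by
    -- `A Dᵀ = 1 + B Cᵀ`, so `A S' = A Dᵀ S D` agrees with `S D` up to a multiple of `N M²`
    have hkey : toC (blockA g) * toC S' = toC S * toC (blockD g)
        + ((N : ℂ) * M ^ 2) • (toC (blockB g) * (toC C₁)ᵀ * toC S * toC (blockD g)) := by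
      rw [hS'def, toC_mul, toC_mul, toC_transpose, ← Matrix.mul_assoc, ← Matrix.mul_assoc, hAD',
        hC₁', transpose_smul, Matrix.mul_smul, Matrix.add_mul, Matrix.one_mul, Matrix.smul_mul,
        Matrix.add_mul, Matrix.smul_mul]
    rw [hA, Matrix.add_mul, hs', Matrix.mul_smul, hkey, Matrix.mul_smul, hC₁', hs]
    simp only [toC_sub, toC_smul, toC_mul, toC_transpose, Matrix.smul_mul, Matrix.mul_smul,
      smul_add, smul_smul]
    have e1 : (M : ℂ)⁻¹ * ((N : ℂ) * (M : ℂ) ^ 2) = (((N : ℤ) * M : ℤ) : ℂ) := by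
      push_cast; field_simp
    have e3 : (M : ℂ)⁻¹ * (((N : ℂ) * (M : ℂ) ^ 2) * (M : ℂ)⁻¹) = ((N : ℤ) : ℂ) := by
      push_cast; field_simp
    simp only [e1, e3]
    abel
  obtain ⟨g', hgA, hgB, hgC, hgD⟩ := exists_conj_translation g hsT hs'T hA hB hD
  refine ⟨g', hgC, fun a b => ?_, fun a b => ?_, fun Z hZ => ⟨?_, ?_⟩⟩
  · rw [hgA, Matrix.add_apply, Matrix.smul_apply, smul_eq_mul]
    exact Int.modEq_iff_dvd.2 ⟨-(M * (S * C₁) a b), by ring⟩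
  · rw [hgD, Matrix.sub_apply, Matrix.smul_apply, smul_eq_mul]
    exact Int.modEq_iff_dvd.2 ⟨M * (C₁ * S') a b, by ring⟩
  · exact denom_add_of_conj hgC (by rw [hgD, hD]) Z
  · exact moebius_add_of_conj (by rw [hgA, hA]) (by rw [hgB, hB, hgA]) hgC (by rw [hgD, hD]) hZ

end Siegel

/-! ### Boundedness at the cusps in degree one, and the change of level -/

namespace Siegel

variable {n : ℕ}

lemma mem_upperHalfSpace_one {Z : Matrix (Fin 1) (Fin 1) ℂ} :
    Z ∈ upperHalfSpace 1 ↔ 0 < (Z 0 0).im := by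
  have h1 : Z.map Complex.im = diagonal fun _ => (Z 0 0).im := by
    ext a b
    fin_cases a; fin_cases b
    simp
  have h2 : Z.IsSymm := by
    ext a b
    fin_cases a; fin_cases b
    rfl
  rw [upperHalfSpace, Set.mem_ofPred_eq, h1, posDef_diagonal_iff]
  simp [h2]

lemma denom_one_apply (g : ModularGroup 1) (Z : Matrix (Fin 1) (Fin 1) ℂ) :
    denom g Z 0 0 = blockC g 0 0 * Z 0 0 + blockD g 0 0 := by
  simp [denom, mul_apply]

lemma det_denom_one (g : ModularGroup 1) (Z : Matrix (Fin 1) (Fin 1) ℂ) :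
    (denom g Z).det = blockC g 0 0 * Z 0 0 + blockD g 0 0 := by
  rw [det_fin_one, denom_one_apply]

lemma moebius_one_apply (g : ModularGroup 1) {Z : Matrix (Fin 1) (Fin 1) ℂ}
    (hZ : Z ∈ upperHalfSpace 1) :
    moebius g Z 0 0 = (blockA g 0 0 * Z 0 0 + blockB g 0 0) /
      (blockC g 0 0 * Z 0 0 + blockD g 0 0) := by
  have h0 := det_denom_ne_zero g hZ
  have h1 : moebius g Z * denom g Z = numer g Z := by
    rw [moebius_eq, Matrix.mul_assoc, nonsing_inv_mul _ (isUnit_det_denom g hZ), Matrix.mul_one]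
  have h2 := congrFun (congrFun h1 0) 0
  rw [det_denom_one] at h0
  rw [eq_div_iff h0]
  simpa [mul_apply, denom_one_apply, numer] using h2

/-- In degree one, an integral matrix of determinant one gives an element of the modular group. -/
lemma exists_modularGroup_one {p u r v : ℤ} (h : p * v - r * u = 1) :
    ∃ g : ModularGroup 1, blockA g 0 0 = p ∧ blockB g 0 0 = u ∧ blockC g 0 0 = r ∧
      blockD g 0 0 = v := by
  have hmem : fromBlocks (of fun _ _ => p) (of fun _ _ => u) (of fun _ _ => r) (of fun _ _ => v)
      ∈ symplecticGroup (Fin 1) ℤ := by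
    rw [SymplecticGroup.fromBlocks_mem_iff]
    refine ⟨?_, ?_, ?_⟩
    · ext a b
      simp [mul_apply, mul_comm]
    · ext a b
      simp [mul_apply, mul_comm]
    · ext a b
      fin_cases a; fin_cases b
      simpa [mul_apply] using h
  exact ⟨⟨_, hmem⟩, rfl, rfl, rfl, rfl⟩

/-- An integral `2 × 2` matrix with positive determinant is the product of an element of `SL_2(ℤ)`
and an upper triangular matrix with positive diagonal. -/
lemma exists_triangular_factorization {p q r t : ℤ} (hdet : 0 < p * t - q * r) :
    ∃ p' u r' v a b d : ℤ, p' * v - r' * u = 1 ∧ 0 < a ∧ 0 < d ∧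
      p = p' * a ∧ r = r' * a ∧ q = p' * b + u * d ∧ t = r' * b + v * d := by
  have hne : ¬ (p = 0 ∧ r = 0) := by
    rintro ⟨rfl, rfl⟩
    simp at hdet
  have hpos : 0 < Int.gcd p r := by
    rw [Int.gcd_pos_iff]
    tauto
  obtain ⟨p', r', hcop, hp, hr⟩ := Int.exists_gcd_one hpos
  obtain ⟨x, y, hxy⟩ := Int.isCoprime_iff_gcd_eq_one.2 hcop
  have ha : (0 : ℤ) < Int.gcd p r := by exact_mod_cast hpos
  set a : ℤ := ((Int.gcd p r : ℕ) : ℤ)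
  have hd : a * (p' * t - r' * q) = p * t - q * r := by rw [hp, hr]; ring
  refine ⟨p', -y, r', x, a, x * q + y * t, p' * t - r' * q, by linear_combination hxy, ha,
    pos_of_mul_pos_right (hd ▸ hdet) ha.le, hp, hr, ?_, ?_⟩
  · linear_combination -q * hxy
  · linear_combination -t * hxy

/-- In degree one, translates of `F` by `S / M` are bounded at all cusps if `F` is: the matrix
`(M S; 0 M) g` is the product of an element of the modular group and a triangular matrix. -/
lemma bdd_at_cusps_translate {k : ℕ} {F : Matrix (Fin 1) (Fin 1) ℂ → ℂ}
    (hF : ∀ g : ModularGroup 1, ∃ c B : ℝ, ∀ Z ∈ upperHalfSpace 1,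
      (∀ i, c ≤ (Z i i).im) → ‖slash k F g Z‖ ≤ B)
    {M : ℕ} (hM : 0 < M) (S : Matrix (Fin 1) (Fin 1) ℤ) (g : ModularGroup 1) :
    ∃ c B : ℝ, ∀ Z ∈ upperHalfSpace 1, (∀ i, c ≤ (Z i i).im) →
      ‖((denom g Z).det ^ k)⁻¹ * F (moebius g Z + (M : ℂ)⁻¹ • toC S)‖ ≤ B := by
  obtain ⟨α, hα⟩ : ∃ x, blockA g 0 0 = x := ⟨_, rfl⟩
  obtain ⟨β, hβ⟩ : ∃ x, blockB g 0 0 = x := ⟨_, rfl⟩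
  obtain ⟨γ, hγ⟩ : ∃ x, blockC g 0 0 = x := ⟨_, rfl⟩
  obtain ⟨δ, hδ⟩ : ∃ x, blockD g 0 0 = x := ⟨_, rfl⟩
  obtain ⟨σ, hσ⟩ : ∃ x, S 0 0 = x := ⟨_, rfl⟩
  have hdet : α * δ - γ * β = 1 := by
    have h := congrFun (congrFun (block_relations g).2.2 0) 0
    simpa [mul_apply, hα, hβ, hγ, hδ] using h
  have hMZ : (0 : ℤ) < M := by exact_mod_cast hM
  obtain ⟨p, u, r, v, a, b, d, hpv, ha, hd, h1, h2, h3, h4⟩ :=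
    exists_triangular_factorization (p := M * α + σ * γ) (q := M * β + σ * δ) (r := M * γ)
      (t := M * δ) (by
        have : (M * α + σ * γ) * (M * δ) - (M * β + σ * δ) * (M * γ) = (M : ℤ) ^ 2 := by
          linear_combination (M : ℤ) ^ 2 * hdet
        rw [this]
        positivity)
  obtain ⟨g', hA', hB', hC', hD'⟩ := exists_modularGroup_one hpv
  obtain ⟨c, B, hcB⟩ := hF g'
  have haR : (0 : ℝ) < a := by exact_mod_cast ha
  have hdR : (0 : ℝ) < d := by exact_mod_cast hd
  have hdC : (d : ℂ) ≠ 0 := by exact_mod_cast hd.ne'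
  have hMC : (M : ℂ) ≠ 0 := by exact_mod_cast hM.ne'
  -- `g` translated by `S / M` acts as `g'` after `Z ↦ W = (aZ + b) / d`
  refine ⟨c * d / a, ((M : ℝ) / d) ^ k * B, fun Z hZ hc => ?_⟩
  set z := Z 0 0 with hz
  set W : Matrix (Fin 1) (Fin 1) ℂ := of fun _ _ => ((a : ℂ) * z + b) / d with hW
  have hW0 : W 0 0 = ((a : ℂ) * z + b) / d := rfl
  have hWim : (W 0 0).im = a / d * z.im := by
    have : W 0 0 = ((a / d : ℝ) : ℂ) * z + ((b / d : ℝ) : ℂ) := by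
      rw [hW0]; push_cast; field_simp
    rw [this, Complex.add_im, Complex.im_ofReal_mul, Complex.ofReal_im, add_zero]
  have hzim := mem_upperHalfSpace_one.1 hZ
  have hWmem : W ∈ upperHalfSpace 1 := by
    rw [mem_upperHalfSpace_one, hWim]
    positivity
  have hbound := hcB W hWmem fun i => by
    rw [Subsingleton.elim i 0, hWim]
    have := hc 0
    rw [div_le_iff₀ haR] at this
    rw [div_mul_eq_mul_div, le_div_iff₀ hdR]
    linarith
  have e1 : (M : ℂ) * α + σ * γ = p * a := by exact_mod_cast h1
  have e2 : (M : ℂ) * γ = r * a := by exact_mod_cast h2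
  have e3 : (M : ℂ) * β + σ * δ = p * b + u * d := by exact_mod_cast h3
  have e4 : (M : ℂ) * δ = r * b + v * d := by exact_mod_cast h4
  have hg0 : (γ : ℂ) * z + δ ≠ 0 := by
    have := det_denom_ne_zero g hZ
    rwa [det_denom_one, hγ, hδ] at this
  have hden : (denom g' W).det = (M / d) * (denom g Z).det := by
    rw [det_denom_one, det_denom_one, hγ, hδ, hC', hD', hW0]
    field_simp
    linear_combination -z * e2 - e4
  have hmoe : moebius g' W = moebius g Z + (M : ℂ)⁻¹ • toC S := by
    have hg0' : (denom g' W).det ≠ 0 := det_denom_ne_zero g' hWmem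
    rw [hden] at hg0'
    ext i l
    rw [Subsingleton.elim i 0, Subsingleton.elim l 0]
    have hS : ((M : ℂ)⁻¹ • toC S) 0 0 = (M : ℂ)⁻¹ * σ := by rw [← hσ]; rfl
    have hd' := hden
    rw [det_denom_one, det_denom_one, hγ, hδ, hC', hD'] at hd'
    rw [Matrix.add_apply, hS, moebius_one_apply g' hWmem, moebius_one_apply g hZ, hα, hβ, hγ, hδ,
      hA', hB', hC', hD', hd', hW0, ← hz]
    obtain ⟨w, hw⟩ : ∃ w, (γ : ℂ) * z + δ = w := ⟨_, rfl⟩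
    rw [hw] at hg0 ⊢
    field_simp
    linear_combination -z * e1 - e3 + (σ : ℂ) * hw
  rw [slash, hden, hmoe] at hbound
  have hMd : ‖(M : ℂ) / d‖ = (M : ℝ) / d := by
    rw [norm_div, Complex.norm_natCast, Complex.norm_intCast, abs_of_pos hdR]
  have hMR : (0 : ℝ) < (M : ℝ) / d := by positivity
  rw [norm_mul, norm_inv, norm_pow, norm_mul, hMd, mul_pow, mul_inv, mul_assoc,
    inv_mul_le_iff₀ (by positivity)] at hbound
  rwa [norm_mul, norm_inv, norm_pow]

/-- For `g ∈ Γ_0(L)` the block `Aᵀ` is an inverse of `D` modulo `L`. -/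
lemma exists_transpose_blockA_mul_blockD {L : ℕ} {g : ModularGroup n} (hg : g ∈ Gamma0 n L) :
    ∃ E : Matrix (Fin n) (Fin n) ℤ, (blockA g)ᵀ * blockD g = 1 + (L : ℤ) • E := by
  obtain ⟨C₁, h⟩ := Classical.skolem.1 fun a =>
    Classical.skolem.1 fun b => Int.modEq_zero_iff_dvd.1 (hg a b)
  have hC : blockC g = (L : ℤ) • Matrix.of C₁ := by
    ext a b; rw [h, Matrix.smul_apply, of_apply, smul_eq_mul]
  refine ⟨(Matrix.of C₁)ᵀ * blockB g, ?_⟩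
  rw [← Matrix.smul_mul, ← transpose_smul, ← hC]
  exact eq_add_of_sub_eq (block_relations g).2.2

/-- On `Γ_0(L)` the determinant of `D` is prime to the level, so that characters modulo `L` do not
take their junk value zero there. -/
lemma isCoprime_det_blockD {L : ℕ} {g : ModularGroup n} (hg : g ∈ Gamma0 n L) :
    IsCoprime (blockD g).det (L : ℤ) := by
  obtain ⟨E, hE⟩ := exists_transpose_blockA_mul_blockD hg
  obtain ⟨m, hm⟩ := dvd_det_sub L 1 E
  rw [← hE, det_mul, det_transpose, det_one] at hm
  exact ⟨(blockA g).det, -m, by linear_combination hm⟩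

/-- The operator `A^{(j)}(M)` raises the level from `N` to `N M²`, for any pair of groups such
that the conjugates by translations of the elements of the second group lie in the first one. -/
theorem isModularForm_opA {j k M N : ℕ} (hM : 0 < M) {Γ Γ' : Set (ModularGroup n)}
    {χ : DirichletCharacter ℂ N} {χ' : DirichletCharacter ℂ (N * M ^ 2)}
    (hΓ : Gamma1 n N ⊆ Γ) (hΓ' : Γ' ⊆ Gamma0 n (N * M ^ 2))
    (hlift : ∀ g ∈ Γ', ∀ g' : ModularGroup n, blockC g' = blockC g →
      MatModEq N (blockA g') (blockA g) → MatModEq N (blockD g') (blockD g) → g' ∈ Γ)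
    (hχ : ∀ g ∈ Γ', χ' (((blockD g).det : ℤ) : ZMod (N * M ^ 2))
      = χ (((blockD g).det : ℤ) : ZMod N))
    {F : Matrix (Fin n) (Fin n) ℂ → ℂ} (hF : IsModularForm k N Γ χ F) :
    (∀ Z ∈ upperHalfSpace n, Summable (termA j M F Z)) ∧
      IsModularForm k (N * M ^ 2) Γ' χ' (opA j M F) := by
  obtain ⟨c, S, hS, hc⟩ := exists_indicator_expansion n j hM
  have hper : ∀ Z ∈ upperHalfSpace n, ∀ S : Matrix (Fin n) (Fin n) ℤ, Sᵀ = S →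
      F (Z + toC S) = F Z := fun Z hZ S hS => hF.translate hΓ hZ hS
  have hsum : ∀ Z ∈ upperHalfSpace n,
      HasSum (termA j M F Z) (∑ u, c u * F (Z + (M : ℂ)⁻¹ • toC (S u))) := fun Z hZ => by
    have := hasSum_termA (D := 1) (D' := 1) (E := 0) hF.holo hper hS hc (by simp) hZ
    simpa using this
  have hop : ∀ Z ∈ upperHalfSpace n,
      opA j M F Z = ∑ u, c u * F (Z + (M : ℂ)⁻¹ • toC (S u)) := fun Z hZ => (hsum Z hZ).tsum_eq
  refine ⟨fun Z hZ => (hsum Z hZ).summable, ?_, ?_, ?_⟩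
  · refine DifferentiableOn.congr ?_ hop
    exact differentiableOn_sum_translate hF.holo _ c _ fun u _ Z hZ => add_smul_toC_mem hZ M (hS u)
  · intro g hg Z hZ
    obtain ⟨E₀, hE₀⟩ := exists_transpose_blockA_mul_blockD (hΓ' hg)
    have hE : (blockA g)ᵀ * blockD g = 1 + (M : ℤ) • (((N : ℤ) * M) • E₀) := by
      rw [hE₀, smul_smul]
      congr 2
      push_cast
      ring
    rw [slash, hop _ (moebius_mem g hZ), opA, (hasSum_termA hF.holo hper hS hc hE hZ).tsum_eq,
      Finset.mul_sum, Finset.mul_sum]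
    refine Finset.sum_congr rfl fun u _ => ?_
    obtain ⟨g', hgC, hgA, hgD, hact⟩ := exists_conj_Gamma0 hM (hΓ' hg) (hS u)
    obtain ⟨hden, hmoe⟩ := hact Z hZ
    have h := hF.slash_eq g' (hlift g hg g' hgC hgA hgD) _
      (add_smul_toC_mem hZ M (transpose_conj_eq (hS u) (blockD g)))
    rw [slash, hden, hmoe] at h
    have hdetD : (((blockD g').det : ℤ) : ZMod N) = ((blockD g).det : ℤ) := by
      change Int.castRingHom (ZMod N) _ = Int.castRingHom (ZMod N) _
      rw [RingHom.map_det, RingHom.map_det]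
      congr 1
      ext a b
      exact (ZMod.intCast_eq_intCast_iff _ _ _).2 (hgD a b)
    rw [hdetD, ← hχ g hg] at h
    rw [mul_left_comm, h, mul_left_comm]
  · rintro rfl g
    have hb := fun u => bdd_at_cusps_translate (hF.bdd_at_cusps rfl) hM (S u) g
    choose c' B hcB using hb
    refine ⟨∑ u, |c' u|, ∑ u, ‖c u‖ * B u, fun Z hZ hc => ?_⟩
    rw [slash, hop _ (moebius_mem g hZ), Finset.mul_sum]
    refine (norm_sum_le _ _).trans (Finset.sum_le_sum fun u _ => ?_)
    rw [mul_left_comm, norm_mul]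
    refine mul_le_mul_of_nonneg_left (hcB u Z hZ fun i => ?_) (norm_nonneg _)
    exact (le_abs_self _).trans ((Finset.single_le_sum (f := fun u => |c' u|)
      (fun u _ => abs_nonneg _) (Finset.mem_univ u)).trans (hc i))

end Siegel

end

theorem theorem4p1 (n j k M N : ℕ) (hj : 0 < j) (hjn : j ≤ n) (hk : 0 < k)
    (hM : 0 < M) (hN : 0 < N) :
    (∀ F : Matrix (Fin n) (Fin n) ℂ → ℂ,
      Siegel.IsModularForm k N (Siegel.Gamma1 n N) 1 F →
        (∀ Z ∈ Siegel.upperHalfSpace n, Summable (Siegel.termA j M F Z)) ∧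
        Siegel.IsModularForm k (N * M ^ 2) (Siegel.Gamma1 n (N * M ^ 2)) 1 (Siegel.opA j M F)) ∧
    (∀ (χ : DirichletCharacter ℂ N) (F : Matrix (Fin n) (Fin n) ℂ → ℂ),
      Siegel.IsModularForm k N (Siegel.Gamma0 n N) χ F →
        (∀ Z ∈ Siegel.upperHalfSpace n, Summable (Siegel.termA j M F Z)) ∧
        Siegel.IsModularForm k (N * M ^ 2) (Siegel.Gamma0 n (N * M ^ 2))
          (DirichletCharacter.changeLevel (Dvd.intro (M ^ 2) rfl) χ) (Siegel.opA j M F)) := by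
  have hdvd : ∀ {x y : ℤ}, x ≡ y [ZMOD ((N * M ^ 2 : ℕ) : ℤ)] → x ≡ y [ZMOD (N : ℤ)] := fun h =>
    h.of_dvd (by exact_mod_cast Dvd.intro (M ^ 2) rfl)
  refine ⟨fun F hF => Siegel.isModularForm_opA hM subset_rfl (fun g hg => hg.1) ?_ ?_ hF,
    fun χ F hF => Siegel.isModularForm_opA hM (fun g hg => hg.1) subset_rfl ?_ ?_ hF⟩
  · intro g hg g' hC hA hD
    refine ⟨fun a b => ?_, fun a b => (hA a b).trans (hdvd (hg.2.1 a b)),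
      fun a b => (hD a b).trans (hdvd (hg.2.2 a b))⟩
    rw [hC]
    exact hdvd (hg.1 a b)
  · intro g hg
    rw [← DirichletCharacter.changeLevel_one (Dvd.intro (M ^ 2) rfl : N ∣ N * M ^ 2),
      DirichletCharacter.changeLevel_eq_cast_of_dvd' _ _ (Siegel.isCoprime_det_blockD hg.1)]
  · intro g hg g' hC _ _ a b
    rw [hC]
    exact hdvd (hg a b)
  · intro g hg
    exact DirichletCharacter.changeLevel_eq_cast_of_dvd' _ _ (Siegel.isCoprime_det_blockD hg)
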